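/- Let $k$ be a commutative ring, $H$ a Hopf algebra over $k$ and $A$ a left $H$-module algebra (associative with unit), i.e. a $k$-algebra and left $H$-module with $h\cdot 1=\varepsilon(h)1$ and $h\cdot(ab)=\sum (h_1\cdot a)(h_2\cdot b)$. Notation. For an $H$-module algebra $A$ let $A^e=A\otimes_k A^{op}$, and let $A^e\#_\nu H$ be the $k$-module $A^e\otimes_k H$ with the associative multiplication $(e\# h)(f\# g)=(e\otimes 1)\,\nu(h\otimes f)\,(1\otimes g)$, where $\nu(h\otimes a\otimes b)=\sum (h_1\cdot a)\otimes(h_3\cdot b)\otimes h_2$. Then $A$ is a left $A^e\#_\nu H$-module via $((a\otimes b)\# h)\cdot x=a(h\cdot x)b$. An $H$-stable ideal is a two-sided ideal stable under $H$ (equivalently a submodule of $A$ over $M_H(A)\subseteq \mathrm{End}_k(A)$, the subalgebra generated by all left and right multiplications and the action of $H$). $A$ is $H$-semiprime if $K^2=0$ implies $K=0$ for every $H$-stable ideal $K$; it is $H$-prime if $A\ne 0$ and $KL=0$ implies $K=0$ or $L=0$ for all $H$-stable ideals $K,L$. Put $Z(A)^H=\{z\in Z(A): h\cdot z=\varepsilon(h)z\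 \text{for all } h\in H\}$; it is large in $A$ if it meets every non-zero $H$-stable ideal non-trivially. For a left module $M$ over a ring $R$ with injective hull $E(M)$, the self-injective hull is $\widehat M=\sum_{f\in \mathrm{Hom}_R(M,E(M))}\mathrm{Im} f$. $M$ is polyform if $\mathrm{Hom}_R(M/N,\widehat M)=0$ for every essential submodule $N$ of $M$; $M$ is self-injective if every $R$-linear map from a submodule of $M$ to $M$ extends to an endomorphism of $M$; $M$ is non-singular if $0$ is the only element of $M$ whose annihilator is an essential left ideal of $R$. For a commutative ring $R$, $Q_{max}(R)=\varinjlim \mathrm{Hom}_R(D,R)$ is its maximal quotient ring, the limit being over the ideals $D$ with zero annihilator. Theorem. Let $A$ be an $H$-semiprime left $H$-module algebra and let $\widehat A$ be the self-injective hull of $A$ as $A^e\#_\nu H$-module. (1) $A$ is a polyform $A^e\#_\nu H$-module and a subdirect product of $H$-prime $H$-module algebras, and the ring $Z(A)^H$ is reduced. (2) $\widehat A$ carries the structure of a left $H$-module algebra which contains $A$ as an $H$-module subalgebra, whose addition is that of $\widehat A$, for which $((a\otimes b)\# h)\cdot y=a(h\cdot y)b$ for $a,b\in A$, $h\in H$,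 $y\in\widehat A$, and whose product satisfies $f(a)\,g(b)=(f\circ g)(ab)$ for all $a,b\in A$ and all $A^e\#_\nu H$-linear endomorphisms $f,g$ of $\widehat A$. With this structure $\widehat A$ is $H$-semiprime and self-injective as $\widehat A^e\#_\nu H$-module, the commutative ring $Z(\widehat A)^H$ is self-injective and von Neumann regular, and $\widehat A$ is non-singular as $Z(\widehat A)^H$-module. (3) If $Z(A)^H$ is large in $A$, then $Z(A)^H\subseteq Z(\widehat A)^H$, $Z(\widehat A)^H=Q_{max}(Z(A)^H)$ over $Z(A)^H$, and $A$ is non-singular as $Z(A)^H$-module. -/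

import Mathlib

open scoped TensorProduct

set_option linter.unusedSectionVars false

universe u v w x

noncomputable section

/-- `A` is a left `H`-module algebra: `A` is a `k`-algebra and a left `H`-module (the two
`k`-structures agree), `h · 1 = ε(h) 1` and `h · (a b) = ∑ (h₁ · a) (h₂ · b)`. -/
class IsHModuleAlgebra (k : Type u) (H : Type v) (A : Type w) [CommRing k] [Ring H]
    [HopfAlgebra k H] [Ring A] [Algebra k A] [Module H A] [IsScalarTower k H A] : Prop where
  smul_one : ∀ h : H, h • (1 : A) = algebraMap k A (Coalgebra.counit h)
  smul_mul : ∀ (h : H) (a b : A), h • (a * b) =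
    LinearMap.mul' k A (TensorProduct.map
      ((LinearMap.toSpanSingleton H A a).restrictScalars k)
      ((LinearMap.toSpanSingleton H A b).restrictScalars k) (Coalgebra.comul h))

section Smash

variable (k : Type u) (H : Type v) (A : Type w) [CommRing k] [Ring H] [HopfAlgebra k H]
  [Ring A] [Algebra k A] [Module H A] [IsScalarTower k H A]

/-- The underlying `k`-module `Aᵉ ⊗ H` of the smash product `Aᵉ #_ν H`, where
`Aᵉ = A ⊗ Aᵒᵖ` is the enveloping algebra. -/
def EnvSmash : Type (max v w) := (A ⊗[k] Aᵐᵒᵖ) ⊗[k] H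

namespace EnvSmash

instance : AddCommGroup (EnvSmash k H A) :=
  inferInstanceAs (AddCommGroup ((A ⊗[k] Aᵐᵒᵖ) ⊗[k] H))

instance : Module k (EnvSmash k H A) :=
  inferInstanceAs (Module k ((A ⊗[k] Aᵐᵒᵖ) ⊗[k] H))

/-- The identity map from `Aᵉ ⊗ H` to the underlying module of `Aᵉ #_ν H`. -/
def of : (A ⊗[k] Aᵐᵒᵖ) ⊗[k] H ≃ₗ[k] EnvSmash k H A := LinearEquiv.refl k _

variable {k H A}

/-- The element `(a ⊗ b) # h` of `Aᵉ #_ν H`. -/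
def tmul (a b : A) (h : H) : EnvSmash k H A :=
  ((a ⊗ₜ[k] MulOpposite.op b) ⊗ₜ[k] h : (A ⊗[k] Aᵐᵒᵖ) ⊗[k] H)

@[elab_as_elim]
theorem induction {P : EnvSmash k H A → Prop} (zero : P 0)
    (tmul : ∀ a b h, P (tmul a b h)) (add : ∀ s t, P s → P t → P (s + t)) (s) : P s := by
  refine TensorProduct.induction_on (motive := fun s => P s) s zero (fun e h => ?_) add
  refine TensorProduct.induction_on (motive := fun e => P (e ⊗ₜ[k] h : (A ⊗[k] Aᵐᵒᵖ) ⊗[k] H)) e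
    ?_ (fun a b => tmul a b.unop h) (fun e f he hf => ?_)
  · rw [TensorProduct.zero_tmul]; exact zero
  · rw [TensorProduct.add_tmul]; exact add _ _ he hf

variable (k H A)

/-- `h` acting on the first factor: `(a ⊗ b) # g ↦ ((h · a) ⊗ b) # g`. -/
def actL : H →ₐ[k] Module.End k (EnvSmash k H A) :=
  (Module.End.rTensorAlgHom k (A ⊗[k] Aᵐᵒᵖ) H).comp
    ((Module.End.rTensorAlgHom k A Aᵐᵒᵖ).comp (Algebra.lsmul k k A))

/-- `h` acting on the second factor: `(a ⊗ b) # g ↦ (a ⊗ (h · b)) # g`. -/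
def actR : H →ₐ[k] Module.End k (EnvSmash k H A) :=
  (Module.End.rTensorAlgHom k (A ⊗[k] Aᵐᵒᵖ) H).comp
    ((Module.End.lTensorAlgHom k Aᵐᵒᵖ A).comp (Algebra.lsmul k k Aᵐᵒᵖ))

/-- `h` acting on the third factor: `(a ⊗ b) # g ↦ (a ⊗ b) # (h g)`. -/
def actM : H →ₐ[k] Module.End k (EnvSmash k H A) :=
  (Module.End.lTensorAlgHom k H (A ⊗[k] Aᵐᵒᵖ)).comp (Algebra.lmul k H)

/-- `e ∈ Aᵉ` acting by multiplication on the left: `f # g ↦ (e f) # g`. -/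
def mulEnv : A ⊗[k] Aᵐᵒᵖ →ₐ[k] Module.End k (EnvSmash k H A) :=
  (Module.End.rTensorAlgHom k (A ⊗[k] Aᵐᵒᵖ) H).comp (Algebra.lmul k (A ⊗[k] Aᵐᵒᵖ))

variable {k H A}

theorem actL_tmul (h : H) (a b : A) (g : H) :
    actL k H A h (tmul a b g) = tmul (h • a) b g := rfl
theorem actR_tmul (h : H) (a b : A) (g : H) :
    actR k H A h (tmul a b g) = tmul a (h • b) g := rfl
theorem actM_tmul (h : H) (a b : A) (g : H) :
    actM k H A h (tmul a b g) = tmul a b (h * g) := rfl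
theorem mulEnv_tmul (c d a b : A) (g : H) :
    mulEnv k H A (c ⊗ₜ MulOpposite.op d) (tmul a b g) = tmul (c * a) (b * d) g := by
  change ((c ⊗ₜ[k] MulOpposite.op d) * (a ⊗ₜ[k] MulOpposite.op b)) ⊗ₜ[k] g = _
  rw [Algebra.TensorProduct.tmul_mul_tmul, ← MulOpposite.op_mul]
  rfl

theorem end_ext {P : Type*} [AddCommGroup P] [Module k P] {f g : EnvSmash k H A →ₗ[k] P}
    (hfg : ∀ a b h, f (tmul a b h) = g (tmul a b h)) : f = g := by
  ext s
  induction s using induction with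
  | zero => simp
  | tmul a b h => exact hfg a b h
  | add s t hs ht => simp [hs, ht]

variable (k H A)

/-- `h ⊗ p ⊗ q ↦ ((a ⊗ b) # g ↦ ((h · a) ⊗ (q · b)) # (p g))`. -/
def act₃ : H ⊗[k] (H ⊗[k] H) →ₐ[k] Module.End k (EnvSmash k H A) :=
  Algebra.TensorProduct.lift (actL k H A)
    (Algebra.TensorProduct.lift (actM k H A) (actR k H A)
      (fun _ _ => end_ext fun _ _ _ => rfl))
    (fun h t => by
      induction t using TensorProduct.induction_on with
      | zero => rw [map_zero]; exact Commute.zero_right _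
      | tmul p q => exact end_ext fun _ _ _ => rfl
      | add s t hs ht => rw [map_add]; exact hs.add_right ht)

/-- The iterated comultiplication `h ↦ ∑ h₁ ⊗ h₂ ⊗ h₃`. -/
def comul₃ : H →ₐ[k] H ⊗[k] (H ⊗[k] H) :=
  (Algebra.TensorProduct.map (AlgHom.id k H) (Bialgebra.comulAlgHom k H)).comp
    (Bialgebra.comulAlgHom k H)

/-- The operator of left multiplication by `1 # h` on `Aᵉ #_ν H`:
`(a ⊗ b) # g ↦ ∑ ((h₁ · a) ⊗ (h₃ · b)) # (h₂ g)`. -/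
def act : H →ₐ[k] Module.End k (EnvSmash k H A) := (act₃ k H A).comp (comul₃ k H)

/-- The map `ν : H ⊗ Aᵉ → Aᵉ ⊗ H`, `ν (h ⊗ a ⊗ b) = ∑ (h₁ · a) ⊗ (h₃ · b) ⊗ h₂`. -/
def twist : H ⊗[k] (A ⊗[k] Aᵐᵒᵖ) →ₗ[k] (A ⊗[k] Aᵐᵒᵖ) ⊗[k] H :=
  TensorProduct.lift ((act k H A).toLinearMap.compl₂
    ((TensorProduct.mk k (A ⊗[k] Aᵐᵒᵖ) H).flip 1))

/-- Left multiplication on `Aᵉ #_ν H`: `e # h` acts as left multiplication by `e` after the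
operator `act h`. -/
def mulLin : EnvSmash k H A →ₗ[k] Module.End k (EnvSmash k H A) :=
  TensorProduct.lift ((LinearMap.mul k (Module.End k (EnvSmash k H A))).compl₁₂
    (mulEnv k H A).toLinearMap (act k H A).toLinearMap)

instance : Mul (EnvSmash k H A) := ⟨fun s t => mulLin k H A s t⟩
instance : One (EnvSmash k H A) := ⟨tmul 1 1 1⟩

variable {k H A}

theorem mul_def (s t : EnvSmash k H A) : s * t = mulLin k H A s t := rfl
theorem one_def : (1 : EnvSmash k H A) = tmul 1 1 1 := rfl

theorem mulLin_tmul (a b : A) (h : H) : mulLin k H A (tmul a b h) =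
    mulEnv k H A (a ⊗ₜ MulOpposite.op b) * act k H A h := rfl

theorem act₃_tmul (h p q : H) : act₃ k H A (h ⊗ₜ (p ⊗ₜ q)) =
    actL k H A h * (actM k H A p * actR k H A q) := rfl

theorem act_eq (h : H) : act k H A h = act₃ k H A
    (TensorProduct.map .id Coalgebra.comul (Coalgebra.comul h)) := rfl

open Coalgebra in
theorem twist_tmul (h : H) (a b : A) :
    twist k H A (h ⊗ₜ (a ⊗ₜ MulOpposite.op b)) = ∑ i ∈ (ℛ k h).index,
      ∑ j ∈ (ℛ k ((ℛ k h).right i)).index,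
        (((ℛ k h).left i • a) ⊗ₜ MulOpposite.op ((ℛ k ((ℛ k h).right i)).right j • b)) ⊗ₜ
          ((ℛ k ((ℛ k h).right i)).left j) := by
  change act k H A h (tmul a b 1) = _
  rw [act_eq, ← (ℛ k h).eq]
  simp only [map_sum, TensorProduct.map_tmul, LinearMap.id_coe, id_eq, LinearMap.sum_apply]
  refine Finset.sum_congr rfl fun i _ => ?_
  conv_lhs => rw [← (ℛ k ((ℛ k h).right i)).eq]
  simp only [TensorProduct.tmul_sum, map_sum, LinearMap.sum_apply]
  refine Finset.sum_congr rfl fun j _ => ?_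
  simp only [act₃_tmul, Module.End.mul_apply, actL_tmul, actM_tmul, actR_tmul, mul_one]
  rfl


section Assoc

variable (a b : A)

/-- `u ⊗ v ↦ (u · a) ∘ (v · -)` on the first factor. -/
def auxL : H ⊗[k] H →ₗ[k] Module.End k (EnvSmash k H A) :=
  TensorProduct.lift ((LinearMap.mul k (Module.End k (EnvSmash k H A))).compl₁₂
    ((mulEnv k H A).toLinearMap ∘ₗ ((TensorProduct.mk k A Aᵐᵒᵖ).flip 1) ∘ₗ
      (LinearMap.toSpanSingleton H A a).restrictScalars k) (actL k H A).toLinearMap)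

/-- `u ⊗ v ↦ (v · b) ∘ (u · -)` on the second factor. -/
def auxR : H ⊗[k] H →ₗ[k] Module.End k (EnvSmash k H A) :=
  TensorProduct.lift ((LinearMap.mul k (Module.End k (EnvSmash k H A))).flip.compl₁₂
    (actR k H A).toLinearMap
    ((mulEnv k H A).toLinearMap ∘ₗ (TensorProduct.mk k A Aᵐᵒᵖ 1) ∘ₗ
      (LinearMap.toSpanSingleton H Aᵐᵒᵖ (MulOpposite.op b)).restrictScalars k))

/-- `(u ⊗ v) ⊗ (p ⊗ (r ⊗ q)) ↦ (u · a) (v · -)`, `p -` and `(q · b) (r · -)` on the three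
factors. -/
def auxG : (H ⊗[k] H) ⊗[k] (H ⊗[k] (H ⊗[k] H)) →ₗ[k] Module.End k (EnvSmash k H A) :=
  TensorProduct.lift ((LinearMap.mul k (Module.End k (EnvSmash k H A))).compl₁₂
    (auxL a) (TensorProduct.lift ((LinearMap.mul k (Module.End k (EnvSmash k H A))).compl₁₂
      (actM k H A).toLinearMap (auxR b))))

theorem auxL_tmul (u v : H) : auxL (k := k) a (u ⊗ₜ v) =
    mulEnv k H A ((u • a) ⊗ₜ MulOpposite.op 1) * actL k H A v := rfl

theorem auxR_tmul (u v : H) : auxR (k := k) b (u ⊗ₜ v) =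
    mulEnv k H A (1 ⊗ₜ MulOpposite.op (v • b)) * actR k H A u := rfl

theorem auxG_tmul (s : H ⊗[k] H) (p : H) (t : H ⊗[k] H) : auxG (k := k) a b (s ⊗ₜ (p ⊗ₜ t)) =
    auxL a s * (actM k H A p * auxR b t) := rfl

variable [IsHModuleAlgebra k H A]

theorem actL_mul_mulEnv (u : H) :
    actL k H A u * mulEnv k H A (a ⊗ₜ MulOpposite.op 1) = auxL a (Coalgebra.comul u) := by
  refine end_ext fun c d g => ?_
  rw [Module.End.mul_apply, mulEnv_tmul, actL_tmul, IsHModuleAlgebra.smul_mul (k := k)]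
  generalize (Coalgebra.comul u : H ⊗[k] H) = t
  induction t using TensorProduct.induction_on with
  | zero => simp [tmul]; rfl
  | tmul p q =>
    rw [auxL_tmul, Module.End.mul_apply, actL_tmul, mulEnv_tmul]; rfl
  | add s t hs ht =>
    rw [map_add, map_add, map_add, LinearMap.add_apply, ← hs, ← ht]
    simp only [tmul, TensorProduct.add_tmul]; rfl

theorem actR_mul_mulEnv (u : H) :
    actR k H A u * mulEnv k H A (1 ⊗ₜ MulOpposite.op b) = auxR b (Coalgebra.comul u) := by
  refine end_ext fun c d g => ?_
  rw [Module.End.mul_apply, mulEnv_tmul, actR_tmul, IsHModuleAlgebra.smul_mul (k := k)]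
  generalize (Coalgebra.comul u : H ⊗[k] H) = t
  induction t using TensorProduct.induction_on with
  | zero => simp [tmul]; rfl
  | tmul p q =>
    rw [auxR_tmul, Module.End.mul_apply, actR_tmul, mulEnv_tmul]; rfl
  | add s t hs ht =>
    rw [map_add, map_add, map_add, LinearMap.add_apply, ← hs, ← ht]
    simp only [tmul, MulOpposite.op_add, TensorProduct.tmul_add, TensorProduct.add_tmul]; rfl

theorem act₃_mul_mulEnv (t : H ⊗[k] (H ⊗[k] H)) :
    act₃ k H A t * mulEnv k H A (a ⊗ₜ MulOpposite.op b) =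
      auxG a b (TensorProduct.map Coalgebra.comul (TensorProduct.map .id Coalgebra.comul) t) := by
  induction t using TensorProduct.induction_on with
  | zero => simp
  | add s t hs ht => simp only [map_add, add_mul, hs, ht]
  | tmul u t =>
    induction t using TensorProduct.induction_on with
    | zero => simp
    | add s t hs ht => simp only [TensorProduct.tmul_add, map_add, add_mul, hs, ht]
    | tmul p q =>
      simp only [TensorProduct.map_tmul, LinearMap.id_coe, id_eq, auxG_tmul, act₃_tmul,
        ← actL_mul_mulEnv, ← actR_mul_mulEnv]
      refine end_ext fun c d g => ?_
      simp only [Module.End.mul_apply, mulEnv_tmul, actL_tmul, actM_tmul, actR_tmul]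
      simp

/-- Reassociation `u ⊗ ((v ⊗ p ⊗ r) ⊗ q) ↦ (u ⊗ v) ⊗ (p ⊗ (r ⊗ q))`. -/
def reassoc (k : Type u) (H : Type v) [CommRing k] [Ring H] [HopfAlgebra k H] :
    H ⊗[k] ((H ⊗[k] (H ⊗[k] H)) ⊗[k] H) →ₗ[k] (H ⊗[k] H) ⊗[k] (H ⊗[k] (H ⊗[k] H)) :=
  (TensorProduct.assoc k _ _ _).symm.toLinearMap ∘ₗ
    TensorProduct.map .id ((TensorProduct.map .id (TensorProduct.assoc k _ _ _).toLinearMap) ∘ₗ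
      (TensorProduct.assoc k _ _ _).toLinearMap)

theorem reassoc_comul (h : H) :
    TensorProduct.map Coalgebra.comul (TensorProduct.map .id Coalgebra.comul) (comul₃ k H h) =
    reassoc k H (TensorProduct.map .id (TensorProduct.map (comul₃ k H).toLinearMap .id)
      (comul₃ k H h)) := by
  have : TensorProduct.map (Coalgebra.comul (R := k) (A := H))
      (TensorProduct.map .id Coalgebra.comul) ∘ₗ TensorProduct.map .id Coalgebra.comul ∘ₗ
        Coalgebra.comul =
      reassoc k H ∘ₗ TensorProduct.map .id
        (TensorProduct.map (TensorProduct.map .id Coalgebra.comul ∘ₗ Coalgebra.comul) .id) ∘ₗ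
        TensorProduct.map .id Coalgebra.comul ∘ₗ Coalgebra.comul := by
    simp only [reassoc, coassoc_simps]
  exact LinearMap.congr_fun this h

theorem mulEnv_mul_act₃ (u q : H) (t : H ⊗[k] (H ⊗[k] H)) :
    mulEnv k H A ((u • a) ⊗ₜ MulOpposite.op (q • b)) * act₃ k H A t =
      auxG a b (reassoc k H (u ⊗ₜ (t ⊗ₜ q))) := by
  induction t using TensorProduct.induction_on with
  | zero => simp
  | add s t hs ht =>
    simp only [TensorProduct.add_tmul, TensorProduct.tmul_add, map_add, mul_add, hs, ht]
  | tmul v t =>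
    induction t using TensorProduct.induction_on with
    | zero => simp
    | add s t hs ht =>
      simp only [TensorProduct.add_tmul, TensorProduct.tmul_add, map_add, mul_add, hs, ht]
    | tmul p r =>
      change _ = auxL a (u ⊗ₜ v) * (actM k H A p * auxR b (r ⊗ₜ q))
      refine end_ext fun c d g => ?_
      simp only [act₃_tmul, auxL_tmul, auxR_tmul, Module.End.mul_apply, mulEnv_tmul, actL_tmul,
        actM_tmul, actR_tmul]
      simp

theorem mulLin_act₃ (t : H ⊗[k] (H ⊗[k] H)) (g : H) :
    mulLin k H A (act₃ k H A t (tmul a b g)) =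
      auxG a b (reassoc k H (TensorProduct.map .id
        (TensorProduct.map (comul₃ k H).toLinearMap .id) t)) * act k H A g := by
  induction t using TensorProduct.induction_on with
  | zero => simp
  | add s t hs ht => simp only [map_add, LinearMap.add_apply, add_mul, hs, ht]
  | tmul u t =>
    induction t using TensorProduct.induction_on with
    | zero => simp
    | add s t hs ht =>
      simp only [TensorProduct.tmul_add, map_add, LinearMap.add_apply, add_mul, hs, ht]
    | tmul p q =>
      simp only [TensorProduct.map_tmul, LinearMap.id_coe, id_eq, AlgHom.toLinearMap_apply,
        ← mulEnv_mul_act₃]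
      simp only [act₃_tmul, Module.End.mul_apply, actL_tmul, actM_tmul, actR_tmul, mulLin_tmul,
        map_mul, mul_assoc]
      rfl

theorem act_mul_mulEnv (h : H) :
    act k H A h * mulEnv k H A (a ⊗ₜ MulOpposite.op b) =
      auxG a b (reassoc k H (TensorProduct.map .id
        (TensorProduct.map (comul₃ k H).toLinearMap .id) (comul₃ k H h))) := by
  rw [← reassoc_comul, ← act₃_mul_mulEnv]; rfl

end Assoc

section Ring

variable [IsHModuleAlgebra k H A]

theorem mulLin_act (h : H) (s : EnvSmash k H A) :
    mulLin k H A (act k H A h s) = act k H A h * mulLin k H A s := by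
  induction s using EnvSmash.induction with
  | zero => simp
  | add s t hs ht => simp only [map_add, mul_add, hs, ht]
  | tmul a b g =>
    rw [mulLin_tmul, ← mul_assoc, act_mul_mulEnv]
    exact mulLin_act₃ a b _ g

theorem mulLin_mulEnv (a b : A) (s : EnvSmash k H A) :
    mulLin k H A (mulEnv k H A (a ⊗ₜ MulOpposite.op b) s) =
      mulEnv k H A (a ⊗ₜ MulOpposite.op b) * mulLin k H A s := by
  induction s using EnvSmash.induction with
  | zero => simp
  | add s t hs ht => simp only [map_add, mul_add, hs, ht]
  | tmul c d g =>
    rw [mulEnv_tmul, mulLin_tmul, mulLin_tmul, ← mul_assoc, ← map_mul,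
      Algebra.TensorProduct.tmul_mul_tmul, ← MulOpposite.op_mul]

theorem mulLin_mulLin (s t : EnvSmash k H A) :
    mulLin k H A (mulLin k H A s t) = mulLin k H A s * mulLin k H A t := by
  induction s using EnvSmash.induction with
  | zero => simp
  | add s t hs ht => simp only [map_add, LinearMap.add_apply, add_mul, hs, ht]
  | tmul a b h =>
    rw [mulLin_tmul, Module.End.mul_apply, mulLin_mulEnv, mulLin_act, mul_assoc]

theorem mulLin_one : mulLin k H A 1 = 1 := by
  rw [one_def, mulLin_tmul, map_one, mul_one]
  exact map_one (mulEnv k H A)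

theorem counit_counit (h : H) :
    TensorProduct.lid k _ (TensorProduct.map Coalgebra.counit
      ((TensorProduct.rid k _).toLinearMap ∘ₗ TensorProduct.map .id Coalgebra.counit)
      (comul₃ k H h)) = h := by
  have h1 : ((TensorProduct.rid k H).toLinearMap ∘ₗ
      TensorProduct.map .id Coalgebra.counit) ∘ₗ Coalgebra.comul = LinearMap.id := by
    ext x
    have := Coalgebra.lTensor_counit_comul (R := k) x
    rw [LinearMap.lTensor_def] at this
    simp [this]
  change TensorProduct.lid k _ (TensorProduct.map Coalgebra.counit
    ((TensorProduct.rid k _).toLinearMap ∘ₗ TensorProduct.map .id Coalgebra.counit)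
      (TensorProduct.map .id Coalgebra.comul (Coalgebra.comul h))) = h
  rw [← LinearMap.comp_apply (TensorProduct.map _ _), ← TensorProduct.map_comp, h1,
    LinearMap.comp_id]
  have := Coalgebra.rTensor_counit_comul (R := k) h
  rw [LinearMap.rTensor_def] at this
  simp [this]

theorem mulLin_apply_one (s : EnvSmash k H A) : mulLin k H A s 1 = s := by
  induction s using EnvSmash.induction with
  | zero => simp
  | add s t hs ht => simp only [map_add, LinearMap.add_apply, hs, ht]
  | tmul a b h =>
    have key : ∀ t : H ⊗[k] (H ⊗[k] H), act₃ k H A t (tmul 1 1 1) =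
        tmul 1 1 (TensorProduct.lid k _ (TensorProduct.map Coalgebra.counit
          ((TensorProduct.rid k _).toLinearMap ∘ₗ TensorProduct.map .id Coalgebra.counit) t)) := by
      intro t
      induction t using TensorProduct.induction_on with
      | zero => simp [tmul]; rfl
      | add s t hs ht =>
        rw [map_add, map_add, map_add, LinearMap.add_apply, hs, ht]
        simp only [tmul, TensorProduct.tmul_add]; rfl
      | tmul u t =>
        induction t using TensorProduct.induction_on with
        | zero => simp [tmul]; rfl
        | add s t hs ht =>
          rw [TensorProduct.tmul_add, map_add, map_add, map_add, LinearMap.add_apply, hs, ht]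
          simp only [tmul, TensorProduct.tmul_add]; rfl
        | tmul p q =>
          simp only [act₃_tmul, Module.End.mul_apply, actL_tmul, actM_tmul, actR_tmul,
            IsHModuleAlgebra.smul_one (k := k), TensorProduct.map_tmul, LinearMap.comp_apply,
            LinearEquiv.coe_coe, TensorProduct.rid_tmul, TensorProduct.lid_tmul,
            LinearMap.id_coe, id_eq, mul_one, Algebra.algebraMap_eq_smul_one]
          simp only [tmul, MulOpposite.op_smul, TensorProduct.smul_tmul, TensorProduct.tmul_smul]
          rw [smul_comm]
    rw [mulLin_tmul, Module.End.mul_apply, one_def]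
    have h2 : act k H A h (tmul 1 1 1) = tmul 1 1 h := by
      have := key (comul₃ k H h)
      rw [counit_counit] at this
      exact this
    rw [h2, mulEnv_tmul, mul_one, one_mul]

instance : Ring (EnvSmash k H A) where
  __ := (inferInstance : AddCommGroup (EnvSmash k H A))
  left_distrib s t u := map_add (mulLin k H A s) t u
  right_distrib s t u := by simp only [mul_def, map_add, LinearMap.add_apply]
  zero_mul s := by simp only [mul_def, map_zero, LinearMap.zero_apply]
  mul_zero s := map_zero (mulLin k H A s)
  mul_assoc s t u := by rw [mul_def, mul_def, mulLin_mulLin]; rfl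
  one_mul s := by rw [mul_def, mulLin_one]; rfl
  mul_one s := mulLin_apply_one s

/-- The product is the one of the smash product for `ν`:
`(e # h) (f # g) = (e ⊗ 1) ν(h ⊗ f) (1 ⊗ g)`. -/
theorem tmul_mul_tmul (e f : A ⊗[k] Aᵐᵒᵖ) (h g : H) :
    of k H A (e ⊗ₜ h) * of k H A (f ⊗ₜ g) =
      of k H A (TensorProduct.map (LinearMap.mulLeft k e) (LinearMap.mulRight k g)
        (twist k H A (h ⊗ₜ f))) := by
  change mulEnv k H A e (act k H A h (of k H A (f ⊗ₜ g))) =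
    of k H A (TensorProduct.map (LinearMap.mulLeft k e) (LinearMap.mulRight k g)
        ((of k H A).symm (act k H A h (of k H A (f ⊗ₜ 1)))))
  rw [act_eq]
  generalize TensorProduct.map LinearMap.id Coalgebra.comul (Coalgebra.comul (R := k) h) = t
  induction t using TensorProduct.induction_on with
  | zero => simp
  | add s t hs ht => simp only [map_add, LinearMap.add_apply, hs, ht]
  | tmul u t =>
    induction t using TensorProduct.induction_on with
    | zero => simp
    | add s t hs ht =>
      simp only [TensorProduct.tmul_add, map_add, LinearMap.add_apply, hs, ht]
    | tmul p q =>
      change of k H A ((e * _) ⊗ₜ[k] (p * g)) = of k H A ((e * _) ⊗ₜ[k] (p * 1 * g))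
      rw [mul_one]

/-- The action of `Aᵉ #_ν H` on `A`: `(a ⊗ b) # h` acts as `L_a ∘ R_b ∘ λ_h`. -/
def toEndLin : EnvSmash k H A →ₗ[k] Module.End k A :=
  TensorProduct.lift ((LinearMap.mul k (Module.End k A)).compl₁₂
    (AlgHom.mulLeftRight k A).toLinearMap (Algebra.lsmul k k A).toLinearMap)

theorem toEndLin_tmul (a b : A) (h : H) (x : A) :
    toEndLin (k := k) (tmul a b h) x = a * (h • x) * b := by
  exact AlgHom.mulLeftRight_apply ..

theorem smul_mul₃ (h : H) (a x b : A) : h • (a * (x * b)) =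
    LinearMap.mul' k A (TensorProduct.map
      ((LinearMap.toSpanSingleton H A a).restrictScalars k)
      (LinearMap.mul' k A ∘ₗ TensorProduct.map
        ((LinearMap.toSpanSingleton H A x).restrictScalars k)
        ((LinearMap.toSpanSingleton H A b).restrictScalars k)) (comul₃ k H h)) := by
  change _ = LinearMap.mul' k A (TensorProduct.map _ _
    (TensorProduct.map .id Coalgebra.comul (Coalgebra.comul h)))
  conv_rhs => rw [← LinearMap.comp_apply (TensorProduct.map _ _), ← TensorProduct.map_comp,
    LinearMap.comp_id]
  rw [IsHModuleAlgebra.smul_mul (k := k)]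
  congr 3
  ext v
  exact IsHModuleAlgebra.smul_mul (k := k) v x b

theorem toEndLin_act (h : H) (s : EnvSmash k H A) :
    toEndLin (act k H A h s) = Algebra.lsmul k k A h * toEndLin s := by
  induction s using EnvSmash.induction with
  | zero => simp
  | add s t hs ht => simp only [map_add, mul_add, hs, ht]
  | tmul a b g =>
    ext x
    rw [Module.End.mul_apply, toEndLin_tmul, Algebra.lsmul_apply, mul_assoc,
      smul_mul₃ (k := k)]
    change toEndLin (act₃ k H A (comul₃ k H h) _) _ = _
    generalize comul₃ k H h = t
    induction t using TensorProduct.induction_on with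
    | zero => simp
    | add s t hs ht => simp only [map_add, LinearMap.add_apply, hs, ht]
    | tmul u t =>
      induction t using TensorProduct.induction_on with
      | zero => simp
      | add s t hs ht =>
        simp only [TensorProduct.tmul_add, map_add, LinearMap.add_apply, hs, ht]
      | tmul p q =>
        simp [act₃_tmul, actL_tmul, actM_tmul, actR_tmul, toEndLin_tmul, mul_smul, mul_assoc]

theorem toEndLin_mulEnv (a b : A) (s : EnvSmash k H A) (x : A) :
    toEndLin (mulEnv k H A (a ⊗ₜ MulOpposite.op b) s) x = a * toEndLin s x * b := by
  induction s using EnvSmash.induction with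
  | zero => simp
  | add s t hs ht => simp only [map_add, LinearMap.add_apply, mul_add, add_mul, hs, ht]
  | tmul c d g => simp [mulEnv_tmul, toEndLin_tmul, mul_assoc]

theorem toEndLin_mul (s t : EnvSmash k H A) :
    toEndLin (s * t) = toEndLin s * toEndLin t := by
  rw [mul_def]
  induction s using EnvSmash.induction with
  | zero => simp
  | add s t hs ht => simp only [map_add, LinearMap.add_apply, add_mul, hs, ht]
  | tmul a b h =>
    ext x
    rw [mulLin_tmul, Module.End.mul_apply, toEndLin_mulEnv, toEndLin_act, Module.End.mul_apply,
      Module.End.mul_apply, toEndLin_tmul, Algebra.lsmul_coe]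

/-- `A` as a left `Aᵉ #_ν H`-module. -/
instance : Module (EnvSmash k H A) A :=
  Module.compHom A (R := Module.End k A)
    { toFun := toEndLin
      map_one' := by ext x; rw [one_def, toEndLin_tmul]; simp
      map_mul' := toEndLin_mul
      map_zero' := map_zero _
      map_add' := map_add _ }

theorem tmul_smul (a b : A) (h : H) (x : A) :
    (tmul a b h : EnvSmash k H A) • x = a * (h • x) * b := toEndLin_tmul a b h x

end Ring

end EnvSmash
end Smash

section HopfModuleAlgebras

variable (k : Type u) (H : Type v) (A : Type w) [CommRing k] [Ring H] [HopfAlgebra k H]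
  [Ring A] [Algebra k A] [Module H A] [IsScalarTower k H A]

/-- The algebra `M_H(A)`: the subalgebra of `End_k(A)` generated by all `L_a`, `R_a`
(`a ∈ A`) and all `λ_h` (`h ∈ H`). -/
def hMulAlgebra : Subalgebra k (Module.End k A) :=
  Algebra.adjoin k
    ({f | ∃ a : A, f = LinearMap.mulLeft k a} ∪ {f | ∃ a : A, f = LinearMap.mulRight k a} ∪
      {f | ∃ h : H, f = Algebra.lsmul k k A h})

/-- `H`-stable two-sided ideals of `A`, i.e. `M_H(A)`-submodules of `A`. -/
abbrev HStableIdeal : Type w := Submodule (hMulAlgebra k H A) A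

/-- `A` is `H`-semiprime: `K² = 0` implies `K = 0` for `H`-stable ideals `K`. -/
def IsHSemiprime : Prop :=
  ∀ K : HStableIdeal k H A, (∀ x ∈ K, ∀ y ∈ K, x * y = 0) → K = ⊥

/-- `A` is `H`-prime: `A ≠ 0`, and `K L = 0` implies `K = 0` or `L = 0` for `H`-stable ideals
`K`, `L`. -/
def IsHPrime : Prop :=
  Nontrivial A ∧ ∀ K L : HStableIdeal k H A,
    (∀ x ∈ K, ∀ y ∈ L, x * y = 0) → K = ⊥ ∨ L = ⊥

/-- `Z(A)^H = Z(A) ∩ A^H`, the central elements `z` with `h · z = ε(h) z` for all `h`. -/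
def centerInvariants [IsHModuleAlgebra k H A] : Subalgebra k A where
  carrier := {z | z ∈ Subalgebra.center k A ∧
    ∀ h : H, h • z = (Coalgebra.counit h : k) • z}
  mul_mem' := by
    rintro y z ⟨hy, hy'⟩ ⟨hz, hz'⟩
    refine ⟨mul_mem hy hz, fun h => ?_⟩
    have key : ∀ t : H ⊗[k] H, LinearMap.mul' k A (TensorProduct.map
        ((LinearMap.toSpanSingleton H A y).restrictScalars k)
        ((LinearMap.toSpanSingleton H A z).restrictScalars k) t) =
        (TensorProduct.lid k k (TensorProduct.map Coalgebra.counit Coalgebra.counit t) : k) •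
          (y * z) := by
      intro t
      induction t using TensorProduct.induction_on with
      | zero => simp
      | add s t hs ht => simp only [map_add, add_smul, hs, ht]
      | tmul p q => simp [hy', hz', smul_smul, mul_comm]
    have h2 : TensorProduct.lid k k (TensorProduct.map Coalgebra.counit Coalgebra.counit
        (Coalgebra.comul (R := k) h)) = Coalgebra.counit h := by
      have h3 := Coalgebra.rTensor_counit_comul (R := k) h
      rw [LinearMap.rTensor_def] at h3
      rw [show (TensorProduct.map (Coalgebra.counit (R := k) (A := H)) Coalgebra.counit) =
        TensorProduct.map .id Coalgebra.counit ∘ₗ TensorProduct.map Coalgebra.counit .id by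
          rw [← TensorProduct.map_comp]; simp, LinearMap.comp_apply, h3]
      simp
    rw [IsHModuleAlgebra.smul_mul (k := k), key, h2]
  add_mem' := by
    rintro y z ⟨hy, hy'⟩ ⟨hz, hz'⟩
    exact ⟨add_mem hy hz, fun h => by rw [smul_add, smul_add, hy', hz']⟩
  algebraMap_mem' c := by
    refine ⟨Subalgebra.algebraMap_mem _ c, fun h => ?_⟩
    rw [Algebra.algebraMap_eq_smul_one, smul_comm h c, IsHModuleAlgebra.smul_one (k := k),
      Algebra.algebraMap_eq_smul_one, smul_comm]

instance [IsHModuleAlgebra k H A] : CommRing (centerInvariants k H A) where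
  __ := (inferInstance : Ring (centerInvariants k H A))
  mul_comm y z := Subtype.ext ((Subalgebra.mem_center_iff.1 z.2.1 y.1))

/-- `Z(A)^H` is large in `A`: it meets every non-zero `H`-stable ideal non-trivially. -/
def CenterInvariantsLarge [IsHModuleAlgebra k H A] : Prop :=
  ∀ I : HStableIdeal k H A, I ≠ ⊥ → ∃ z ∈ centerInvariants k H A, z ∈ I ∧ z ≠ 0

/-- Bundled left `H`-module algebras. -/
structure HModAlg (k : Type u) (H : Type v) [CommRing k] [Ring H] [HopfAlgebra k H] :
    Type (max u v (x + 1)) where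
  carrier : Type x
  [ring : Ring carrier]
  [algebra : Algebra k carrier]
  [module : Module H carrier]
  [tower : IsScalarTower k H carrier]
  [hModuleAlgebra : IsHModuleAlgebra k H carrier]

namespace HModAlg

variable {k H}

instance : CoeSort (HModAlg.{u, v, x} k H) (Type x) := ⟨carrier⟩

attribute [instance] ring algebra module tower hModuleAlgebra

end HModAlg

/-- `A` is a subdirect product of `H`-prime `H`-module algebras: there are `H`-prime module
algebras `P i` and surjective `H`-linear algebra maps `A → P i` which are jointly injective. -/
def IsSubdirectProductOfHPrimes : Prop :=
  ∃ (I : Type w) (P : I → HModAlg.{u, v, w} k H) (p : ∀ i, A →ₐ[k] P i),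
    (∀ i, IsHPrime k H (P i)) ∧
    (∀ i, Function.Surjective (p i)) ∧
    (∀ i (h : H) (a : A), p i (h • a) = h • p i a) ∧
    Function.Injective (fun (a : A) (i : I) => p i a)

end HopfModuleAlgebras

section Modules

variable (R : Type u) [Ring R] (M : Type v) [AddCommGroup M] [Module R M]
  (E : Type w) [AddCommGroup E] [Module R E]

variable {R M} in
/-- `N` is an essential submodule of `M`. -/
def IsEssentialSubmodule (N : Submodule R M) : Prop :=
  ∀ L : Submodule R M, N ⊓ L = ⊥ → L = ⊥

variable {R M E} in
/-- `ι : M → E` is an injective hull of `M`: an essential embedding into an injective module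
(injectivity, for modules in all universes, is expressed by Baer's criterion). -/
structure IsInjectiveHull (ι : M →ₗ[R] E) : Prop where
  injective : Function.Injective ι
  essential : IsEssentialSubmodule (LinearMap.range ι)
  baer : Module.Baer R E

/-- The self-injective hull `M̂` of `M`, where `E` is an injective hull of `M`: the largest
`M`-generated submodule of `E`, i.e. the sum of the images of all `R`-linear maps `M → E`. -/
def selfInjectiveHull : Submodule R E := ⨆ f : M →ₗ[R] E, LinearMap.range f

variable {R M E} in
/-- The inclusion of `M` into its self-injective hull. -/
def toSelfInjectiveHull (ι : M →ₗ[R] E) : M →ₗ[R] selfInjectiveHull R M E :=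
  ι.codRestrict _ fun m => le_iSup (fun f : M →ₗ[R] E => LinearMap.range f) ι ⟨m, rfl⟩

variable {M} in
/-- `N` is dense in `M`, where `E` is an injective hull of `M`: `Hom (M / N, M̂) = 0`. -/
def IsDenseSubmodule (N : Submodule R M) : Prop :=
  ∀ f : (M ⧸ N) →ₗ[R] selfInjectiveHull R M E, f = 0

/-- `M` is polyform, where `E` is an injective hull of `M`: every essential submodule of `M` is
dense in `M`. -/
def IsPolyform : Prop :=
  ∀ N : Submodule R M, IsEssentialSubmodule N → IsDenseSubmodule R E N

/-- `M` is self-injective (that is, `M`-injective): every linear map from a submodule of `M` to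
`M` extends to an endomorphism of `M`. -/
def IsSelfInjective : Prop :=
  ∀ (N : Submodule R M) (f : N →ₗ[R] M), ∃ g : M →ₗ[R] M, ∀ n : N, g n = f n

/-- `M` is non-singular: only `0` has an essential left annihilator ideal. -/
def IsNonsingular : Prop :=
  ∀ m : M, IsEssentialSubmodule (LinearMap.ker (LinearMap.toSpanSingleton R M m)) → m = 0

/-- `R` is von Neumann regular. -/
def IsVonNeumannRegular : Prop := ∀ a : R, ∃ b : R, a * b * a = a

end Modules

section MaximalQuotientRing

variable {R : Type u} {Q : Type v} [CommRing R] [CommRing Q]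

/-- An ideal of a commutative ring is dense if its annihilator is zero. -/
def IsDenseIdeal (D : Ideal R) : Prop := ∀ r : R, (∀ d ∈ D, r * d = 0) → r = 0

/-- `i : R → Q` is the maximal (complete) quotient ring of the commutative ring `R`, i.e.
`Q = lim Hom_R(D, R)` over the dense ideals `D` of `R`: every `q ∈ Q` multiplies some dense ideal
into `R`, every linear map from a dense ideal to `R` is multiplication by some `q ∈ Q`, and
`q = 0` as soon as `q` annihilates some dense ideal. -/
structure IsMaximalQuotientRing (i : R →+* Q) : Prop where
  injective : Function.Injective i
  exists_dense : ∀ q : Q, ∃ D : Ideal R, IsDenseIdeal D ∧ ∀ d ∈ D, ∃ r : R, q * i d = i r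
  eq_zero : ∀ (q : Q) (D : Ideal R), IsDenseIdeal D → (∀ d ∈ D, q * i d = 0) → q = 0
  exists_eq : ∀ (D : Ideal R) (f : D →ₗ[R] R), IsDenseIdeal D →
    ∃ q : Q, ∀ d : D, q * i d = i (f d)

end MaximalQuotientRing

end

/-! Everything in the hull construction rests on one vanishing fact: over an `H`-semiprime `A`, a
linear map f : A → E with essential kernel N is zero. If x ∈ N and y = f(z) lies in A, then xy =
f(xz) = 0, because xz ∈ N. So N annihilates f(A) ∩ A, semiprimeness gives f(A) ∩ A = 0, and A is
essential in E (`eq_zero_of_essential_ker`). Polyformity is a special case.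

Let B = End(Â). Injectivity of E, together with Â being generated by images of A, extends partial
maps into Â to elements of B (`EnvHull.exists_extension`); hence Â is the sum of the f(A) with f ∈
B. By the vanishing fact an element of B is determined by its values on A, and B is commutative: if
f(x) and g(y) lie in A, then fg(xy) and gf(xy) both equal f(x)g(y), and the products xy of this kind
make the kernel of fg - gf on A essential (`EnvHull.end_comm`). Commutativity makes the kernel of f
⊗ a ↦ f(a), from B ⊗ A onto Â, a two-sided ideal, and the product of Â is the one of the quotient.
The elements of B then become exactly the multiplications by elements of Z(Â)^H, via f ↦ f(1).

Thus a functional relation on Â compatible with the module structure is always given by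
multiplication by a central invariant (`exists_centerInvariants_of_graph`). Regularity,
self-injectivity and non-singularity each follow from a suitable choice of relation. If Z(A)^H is
large, non-vanishing in Â can be tested on Z(A)^H; this makes dense ideals of Z(A)^H faithful on Â
and the ideals {d : qd ∈ Z(A)^H} dense, and one more relation extends maps defined on dense ideals.

The subdirect decomposition is independent of the hull: every nonzero x starts a sequence of nonzero
products, and an `H`-stable ideal maximal among those avoiding the sequence is `H`-prime
(`IsHSemiprime.exists_prime`). -/

/-! ### `H`-stable ideals as additive subgroups -/

section Bridges

variable {k : Type u} {H : Type v} {A : Type w} [CommRing k] [Ring H] [HopfAlgebra k H]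
  [Ring A] [Algebra k A] [Module H A] [IsScalarTower k H A]

/-- An additive subgroup of `A` that is a two-sided ideal stable under the action of `H`. -/
structure IsHIdeal (H : Type v) {A : Type w} [Ring H] [Ring A] [Module H A]
    (S : AddSubgroup A) : Prop where
  mul_left : ∀ (a : A) {x : A}, x ∈ S → a * x ∈ S
  mul_right : ∀ (a : A) {x : A}, x ∈ S → x * a ∈ S
  smul : ∀ (h : H) {x : A}, x ∈ S → h • x ∈ S

theorem IsHIdeal.hMulAlgebra_smul_mem {S : AddSubgroup A} (hS : IsHIdeal H S)
    (c : hMulAlgebra k H A) {x : A} (hx : x ∈ S) : c • x ∈ S := by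
  obtain ⟨c, hc⟩ := c
  change c x ∈ S
  induction hc using Algebra.adjoin_induction generalizing x with
  | mem f hf =>
    obtain (⟨a, rfl⟩ | ⟨a, rfl⟩) | ⟨h, rfl⟩ := hf
    · exact hS.mul_left a hx
    · exact hS.mul_right a hx
    · exact hS.smul h hx
  | algebraMap r =>
    -- Scalars of `k` need no separate closure condition: they act as left multiplication by
    -- elements of A.
    rw [Module.algebraMap_end_apply, Algebra.smul_def]
    exact hS.mul_left _ hx
  | add f g _ _ hf hg => exact add_mem (hf hx) (hg hx)
  | mul f g _ _ hf hg => exact hf (hg hx)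

/-- The `H`-stable ideal with a given underlying additive group. -/
def IsHIdeal.toHStableIdeal (k : Type u) [CommRing k] [HopfAlgebra k H] [Algebra k A]
    [IsScalarTower k H A] {S : AddSubgroup A} (hS : IsHIdeal H S) : HStableIdeal k H A where
  carrier := S
  add_mem' := S.add_mem
  zero_mem' := S.zero_mem
  smul_mem' c _ hx := hS.hMulAlgebra_smul_mem c hx

theorem HStableIdeal.isHIdeal (K : HStableIdeal k H A) :
    IsHIdeal H (Submodule.toAddSubgroup (R := hMulAlgebra k H A) (M := A) K) where
  mul_left a _ hx := K.smul_mem ⟨LinearMap.mulLeft k a,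
    Algebra.subset_adjoin (Or.inl (Or.inl ⟨a, rfl⟩))⟩ hx
  mul_right a _ hx := K.smul_mem ⟨LinearMap.mulRight k a,
    Algebra.subset_adjoin (Or.inl (Or.inr ⟨a, rfl⟩))⟩ hx
  smul h _ hx := K.smul_mem ⟨Algebra.lsmul k k A h, Algebra.subset_adjoin (Or.inr ⟨h, rfl⟩)⟩ hx

theorem IsHIdeal.eq_zero_of_sq (hA : IsHSemiprime k H A) {S : AddSubgroup A} (hS : IsHIdeal H S)
    (h : ∀ x ∈ S, ∀ y ∈ S, x * y = 0) {x : A} (hx : x ∈ S) : x = 0 := by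
  have := hA (hS.toHStableIdeal k) h
  rw [← Submodule.mem_bot (R := hMulAlgebra k H A), ← this]
  exact hx

theorem IsHIdeal.inf {S T : AddSubgroup A} (hS : IsHIdeal H S) (hT : IsHIdeal H T) :
    IsHIdeal H (S ⊓ T) where
  mul_left a _ hx := ⟨hS.mul_left a hx.1, hT.mul_left a hx.2⟩
  mul_right a _ hx := ⟨hS.mul_right a hx.1, hT.mul_right a hx.2⟩
  smul h _ hx := ⟨hS.smul h hx.1, hT.smul h hx.2⟩

end Bridges

/-! ### Linearity over the smash product, tested on generators -/

namespace EnvSmash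

variable {k : Type u} {H : Type v} {A : Type w} [CommRing k] [Ring H] [HopfAlgebra k H]
  [Ring A] [Algebra k A] [Module H A] [IsScalarTower k H A] [IsHModuleAlgebra k H A]

section General

variable {M : Type*} [AddCommGroup M] [Module (EnvSmash k H A) M]
  {N : Type*} [AddCommGroup N] [Module (EnvSmash k H A) N]

/-- Additive maps commuting with the generators of `Aᵉ #_ν H` are linear. -/
def mkLinearMap (f : M →+ N) (hf : ∀ (a b : A) (h : H) (x : M),
    f ((tmul a b h : EnvSmash k H A) • x) = (tmul a b h : EnvSmash k H A) • f x) :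
    M →ₗ[EnvSmash k H A] N where
  __ := f
  map_smul' s x := by
    change f (s • x) = s • f x
    induction s using EnvSmash.induction with
    | zero => simp
    | tmul a b h => exact hf a b h x
    | add s t hs ht => simp only [add_smul, map_add, hs, ht]

@[simp]
theorem mkLinearMap_apply (f : M →+ N) (hf) (x : M) :
    mkLinearMap (k := k) (H := H) (A := A) f hf x = f x := rfl

/-- Additive subgroups stable under the generators of `Aᵉ #_ν H` are submodules. -/
def mkSubmodule (S : AddSubgroup M) (hS : ∀ (a b : A) (h : H), ∀ x ∈ S,
    (tmul a b h : EnvSmash k H A) • x ∈ S) : Submodule (EnvSmash k H A) M where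
  carrier := S
  add_mem' := S.add_mem
  zero_mem' := S.zero_mem
  smul_mem' s x hx := by
    change s • x ∈ S
    induction s using EnvSmash.induction with
    | zero => rw [zero_smul]; exact S.zero_mem
    | tmul a b h => exact hS a b h x hx
    | add s t hs ht => rw [add_smul]; exact add_mem hs ht

end General

theorem act_one_tmul (h : H) : act k H A h 1 = tmul 1 1 h := by
  rw [← mulLin_apply_one (tmul 1 1 h), mulLin_tmul]
  change _ = mulEnv k H A 1 (act k H A h 1)
  rw [map_one (mulEnv k H A), Module.End.one_apply]

theorem tmul_one_mul (a b : A) (s : EnvSmash k H A) :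
    tmul a b 1 * s = mulEnv k H A (a ⊗ₜ MulOpposite.op b) s := by
  rw [mul_def, mulLin_tmul, map_one, mul_one]

theorem one_tmul_mul (h : H) (s : EnvSmash k H A) :
    tmul 1 1 h * s = act k H A h s := by
  rw [mul_def, mulLin_tmul]
  change mulEnv k H A 1 (act k H A h s) = _
  rw [map_one (mulEnv k H A), Module.End.one_apply]

variable (k H A) in
/-- The ring homomorphism `h ↦ 1 # h`. -/
def ofHopf : H →+* EnvSmash k H A where
  toFun h := tmul 1 1 h
  map_one' := rfl
  map_mul' g h := by
    rw [one_tmul_mul, ← act_one_tmul, ← act_one_tmul, map_mul]; rfl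
  map_zero' := TensorProduct.tmul_zero _ _
  map_add' := TensorProduct.tmul_add _

theorem ofHopf_apply (h : H) : ofHopf k H A h = tmul 1 1 h := rfl

/-- The scalar moves across the tensor product to the factor A. This yields the compatibility of the
`k`- and `H`-actions on the hull, where `k` acts through A. -/
theorem tmul_smul_right (c : k) (h : H) :
    (tmul 1 1 (c • h) : EnvSmash k H A) = tmul (algebraMap k A c) 1 1 * tmul 1 1 h := by
  rw [tmul_one_mul, mulEnv_tmul, mul_one, mul_one, Algebra.algebraMap_eq_smul_one]
  simp only [tmul, TensorProduct.smul_tmul', TensorProduct.tmul_smul]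
  rfl

theorem left_smul (a x : A) : (tmul a 1 1 : EnvSmash k H A) • x = a * x := by
  simp [tmul_smul]
theorem right_smul (a x : A) : (tmul 1 a 1 : EnvSmash k H A) • x = x * a := by
  simp [tmul_smul]
theorem ofHopf_smul (h : H) (x : A) : ofHopf k H A h • x = h • x := by
  simp [ofHopf_apply, tmul_smul]

theorem isHIdeal (N : Submodule (EnvSmash k H A) A) : IsHIdeal H N.toAddSubgroup where
  mul_left a x hx := by simpa [tmul_smul] using N.smul_mem (tmul a 1 1) hx
  mul_right a x hx := by simpa [tmul_smul] using N.smul_mem (tmul 1 a 1) hx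
  smul h x hx := by simpa [tmul_smul] using N.smul_mem (tmul 1 1 h) hx

end EnvSmash

/-! ### Essential submodules of a semiprime module algebra, and polyformity -/

section Essential

open EnvSmash

variable {k : Type u} {H : Type v} {A : Type w} [CommRing k] [Ring H] [HopfAlgebra k H]
  [Ring A] [Algebra k A] [Module H A] [IsScalarTower k H A] [IsHModuleAlgebra k H A]
  {E : Type x} [AddCommGroup E] [Module (EnvSmash k H A) E]

/-- The `H`-stable ideal N ∩ L has square zero. -/
theorem IsEssentialSubmodule.eq_bot_of_mul_eq_zero (hA : IsHSemiprime k H A)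
    {N L : Submodule (EnvSmash k H A) A} (hN : IsEssentialSubmodule N)
    (h : ∀ x ∈ N, ∀ y ∈ L, x * y = 0) : L = ⊥ := by
  refine hN L (eq_bot_iff.2 fun x hx => ?_)
  exact (isHIdeal (N ⊓ L)).eq_zero_of_sq hA (fun x hx y hy => h x hx.1 y hy.2) hx

/-- If K ∩ L = 0, then N ∩ L squares into K ∩ L and is therefore zero by semiprimeness. -/
theorem IsEssentialSubmodule.of_mul_mem (hA : IsHSemiprime k H A)
    {N K : Submodule (EnvSmash k H A) A} (hN : IsEssentialSubmodule N)
    (h : ∀ x ∈ N, ∀ y ∈ N, x * y ∈ K) : IsEssentialSubmodule K := by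
  refine fun L hL => hN L (eq_bot_iff.2 fun x hx => ?_)
  refine (isHIdeal (N ⊓ L)).eq_zero_of_sq hA (fun x hx y hy => ?_) hx
  have : x * y ∈ K ⊓ L := ⟨h x hx.1 y hy.1, (isHIdeal L).mul_left x hy.2⟩
  rwa [hL] at this

/-- If L meets f⁻¹(K) trivially, then f(L) meets K trivially, so f(L) = 0 and L lies in ker f ⊆
f⁻¹(K). -/
theorem IsEssentialSubmodule.comap {R : Type*} [Ring R] {M N : Type*} [AddCommGroup M] [Module R M]
    [AddCommGroup N] [Module R N] {K : Submodule R N} (hK : IsEssentialSubmodule K)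
    (f : M →ₗ[R] N) : IsEssentialSubmodule (K.comap f) := by
  intro L hL
  have key : L.map f = ⊥ := by
    refine hK _ (eq_bot_iff.2 ?_)
    rintro _ ⟨h1, l, hl, rfl⟩
    have : l ∈ K.comap f ⊓ L := ⟨h1, hl⟩
    rw [hL, Submodule.mem_bot] at this
    rw [this, map_zero]; exact Submodule.zero_mem _
  refine eq_bot_iff.2 fun l hl => ?_
  rw [← hL]
  refine ⟨?_, hl⟩
  have : f l ∈ L.map f := ⟨l, hl, rfl⟩
  rw [key, Submodule.mem_bot] at this
  rw [SetLike.mem_coe, Submodule.mem_comap, this]; exact K.zero_mem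

theorem IsEssentialSubmodule.inf {R : Type*} [Ring R] {M : Type*} [AddCommGroup M] [Module R M]
    {K N : Submodule R M} (hK : IsEssentialSubmodule K) (hN : IsEssentialSubmodule N) :
    IsEssentialSubmodule (K ⊓ N) := fun L hL =>
  hN L (hK _ (by rw [← inf_assoc, hL]))

/-- The kernel annihilates f(A) ∩ A from the left: x f(z) = f(xz), and xz stays in the kernel since
it is also a right ideal. -/
theorem eq_zero_of_essential_ker (hA : IsHSemiprime k H A) {ι : A →ₗ[EnvSmash k H A] E}
    (hι : IsInjectiveHull ι) (f : A →ₗ[EnvSmash k H A] E)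
    (hf : IsEssentialSubmodule (LinearMap.ker f)) : f = 0 := by
  have key : (LinearMap.range f).comap ι = ⊥ := by
    refine hf.eq_bot_of_mul_eq_zero hA ?_
    rintro x hx y ⟨z, hz⟩
    refine hι.injective ?_
    have h1 := map_smul ι (tmul x 1 1) y
    have h2 := map_smul f (tmul x 1 1) z
    rw [left_smul] at h1 h2
    rw [h1, ← hz, ← h2, map_zero]
    exact (isHIdeal (LinearMap.ker f)).mul_right z hx
  have h2 : LinearMap.range f = ⊥ := by
    refine hι.essential _ (eq_bot_iff.2 ?_)
    rintro _ ⟨⟨y, rfl⟩, hy⟩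
    have : y ∈ (LinearMap.range f).comap ι := hy
    rw [key, Submodule.mem_bot] at this
    simp [this]
  exact LinearMap.range_eq_bot.1 h2

theorem isPolyform_of_isHSemiprime (hA : IsHSemiprime k H A) {ι : A →ₗ[EnvSmash k H A] E}
    (hι : IsInjectiveHull ι) : IsPolyform (EnvSmash k H A) A E := by
  intro N hN f
  have : (selfInjectiveHull (EnvSmash k H A) A E).subtype ∘ₗ f ∘ₗ N.mkQ = 0 := by
    refine eq_zero_of_essential_ker hA hι _ fun L hL => hN L (eq_bot_iff.2 fun x hx => ?_)
    rw [← hL]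
    refine ⟨?_, hx.2⟩
    have h0 : N.mkQ x = 0 := (Submodule.Quotient.mk_eq_zero N).2 hx.1
    simp only [SetLike.mem_coe, LinearMap.mem_ker, LinearMap.comp_apply, h0, map_zero]
  ext x
  simpa using LinearMap.congr_fun this x

end Essential

/-! ### Central invariants act by linear maps; reducedness -/

section CenterInvariants

variable {k : Type u} {H : Type v} {A : Type w} [CommRing k] [Ring H] [HopfAlgebra k H]
  [Ring A] [Algebra k A] [Module H A] [IsScalarTower k H A] [IsHModuleAlgebra k H A]

theorem centerInvariants_comm (z : centerInvariants k H A) (x : A) : x * z = z * x :=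
  Subalgebra.mem_center_iff.1 z.2.1 x

/-- Invariance turns h₁ · z into ε(h₁) z, and the counit axiom collapses the coproduct. -/
theorem mul_centerInvariants_smul (z : centerInvariants k H A) (h : H) (x : A) :
    h • (z * x : A) = z * (h • x) := by
  have key : ∀ t : H ⊗[k] H, LinearMap.mul' k A (TensorProduct.map
      ((LinearMap.toSpanSingleton H A (z : A)).restrictScalars k)
      ((LinearMap.toSpanSingleton H A x).restrictScalars k) t) =
      z * (TensorProduct.lid k H (TensorProduct.map Coalgebra.counit .id t) • x) := by
    intro t
    induction t using TensorProduct.induction_on with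
    | zero => simp
    | add s t hs ht => simp only [map_add, add_smul, mul_add, hs, ht]
    | tmul p q => simp [z.2.2]
  rw [IsHModuleAlgebra.smul_mul (k := k), key]
  have := Coalgebra.rTensor_counit_comul (R := k) h
  rw [LinearMap.rTensor_def] at this
  rw [this]; simp

theorem isHIdeal_map_mulLeft {S : AddSubgroup A} (hS : IsHIdeal H S)
    (z : centerInvariants k H A) : IsHIdeal H (S.map (AddMonoidHom.mulLeft (z : A))) where
  mul_left := by
    rintro a _ ⟨x, hx, rfl⟩
    refine ⟨a * x, hS.mul_left a hx, ?_⟩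
    simp [← mul_assoc, centerInvariants_comm]
  mul_right := by
    rintro a _ ⟨x, hx, rfl⟩
    exact ⟨x * a, hS.mul_right a hx, by simp [mul_assoc]⟩
  smul := by
    rintro h _ ⟨x, hx, rfl⟩
    exact ⟨h • x, hS.smul h hx, by simp [mul_centerInvariants_smul]⟩

theorem isHIdeal_top : IsHIdeal H (⊤ : AddSubgroup A) := ⟨by simp, by simp, by simp⟩

theorem isHIdeal_annihilator (I : Set (centerInvariants k H A)) :
    IsHIdeal H (⨅ z ∈ I, (AddMonoidHom.mulLeft (z : A)).ker) where
  mul_left a x hx := by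
    simp only [AddSubgroup.mem_iInf, AddMonoidHom.mem_ker, AddMonoidHom.coe_mulLeft] at hx ⊢
    intro z hz
    rw [← mul_assoc, ← centerInvariants_comm, mul_assoc, hx z hz, mul_zero]
  mul_right a x hx := by
    simp only [AddSubgroup.mem_iInf, AddMonoidHom.mem_ker, AddMonoidHom.coe_mulLeft] at hx ⊢
    intro z hz
    rw [← mul_assoc, hx z hz, zero_mul]
  smul h x hx := by
    simp only [AddSubgroup.mem_iInf, AddMonoidHom.mem_ker, AddMonoidHom.coe_mulLeft] at hx ⊢
    intro z hz
    rw [← mul_centerInvariants_smul, hx z hz, smul_zero]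

/-- The `H`-stable ideal zA contains z, and by centrality its square lies in z²A = 0. -/
theorem eq_zero_of_mul_self (hA : IsHSemiprime k H A) (z : centerInvariants k H A)
    (hz : (z : A) * z = 0) : z = 0 := by
  refine Subtype.ext ((isHIdeal_map_mulLeft (k := k) isHIdeal_top z).eq_zero_of_sq hA ?_
    ⟨1, trivial, by simp⟩)
  rintro _ ⟨x, -, rfl⟩ _ ⟨y, -, rfl⟩
  simp only [AddMonoidHom.coe_mulLeft]
  rw [mul_assoc, ← mul_assoc x, centerInvariants_comm, ← mul_assoc, ← mul_assoc, hz, zero_mul,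
    zero_mul]

theorem isReduced_centerInvariants (hA : IsHSemiprime k H A) :
    IsReduced (centerInvariants k H A) := by
  refine isReduced_iff_pow_one_lt 2 one_lt_two |>.2 fun z hz => ?_
  refine eq_zero_of_mul_self hA z ?_
  rw [pow_two] at hz
  exact congrArg Subtype.val hz

end CenterInvariants

/-! ### Quotient module algebras and the subdirect decomposition -/

section Quotient

variable {k : Type u} {H : Type v} {A : Type w} [CommRing k] [Ring H] [HopfAlgebra k H]
  [Ring A] [Algebra k A] [Module H A] [IsScalarTower k H A]

/-- The two-sided ideal underlying an `H`-stable ideal. -/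
def IsHIdeal.ideal {S : AddSubgroup A} (hS : IsHIdeal H S) : Ideal A where
  carrier := S
  add_mem' := S.add_mem
  zero_mem' := S.zero_mem
  smul_mem' a _ hx := hS.mul_left a hx

theorem IsHIdeal.mem_ideal {S : AddSubgroup A} (hS : IsHIdeal H S) {x : A} :
    x ∈ hS.ideal ↔ x ∈ S := Iff.rfl

instance {S : AddSubgroup A} (hS : IsHIdeal H S) : hS.ideal.IsTwoSided where
  mul_mem_of_left b hx := hS.mul_right b hx

theorem IsHIdeal.comap {B : Type*} [Ring B] [Module H B] {S : AddSubgroup B}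
    (hS : IsHIdeal H S) (f : A →+* B) (hf : ∀ (h : H) (a : A), f (h • a) = h • f a) :
    IsHIdeal H (S.comap (f : A →+ B)) where
  mul_left a x hx := by
    change f (a * x) ∈ S
    rw [map_mul]
    exact hS.mul_left _ hx
  mul_right a x hx := by
    change f (x * a) ∈ S
    rw [map_mul]
    exact hS.mul_right _ hx
  smul h x hx := by
    change f (h • x) ∈ S
    rw [hf]
    exact hS.smul h hx

/-- The action of `H` on the quotient by an `H`-stable ideal. -/
noncomputable instance {S : AddSubgroup A} (hS : IsHIdeal H S) : SMul H (A ⧸ hS.ideal) where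
  smul h x := QuotientAddGroup.map hS.ideal.toAddSubgroup hS.ideal.toAddSubgroup
    (DistribSMul.toAddMonoidHom A h) (fun _ hx => hS.smul h hx) x

theorem IsHIdeal.smul_mk {S : AddSubgroup A} (hS : IsHIdeal H S) (h : H) (a : A) :
    h • Ideal.Quotient.mk hS.ideal a = Ideal.Quotient.mk hS.ideal (h • a) := rfl

noncomputable instance {S : AddSubgroup A} (hS : IsHIdeal H S) : Module H (A ⧸ hS.ideal) :=
  Function.Surjective.module H (Ideal.Quotient.mk hS.ideal).toAddMonoidHom
    Ideal.Quotient.mk_surjective (fun _ _ => rfl)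

instance {S : AddSubgroup A} (hS : IsHIdeal H S) : IsScalarTower k H (A ⧸ hS.ideal) where
  smul_assoc c h y := by
    obtain ⟨a, rfl⟩ := Ideal.Quotient.mk_surjective y
    rw [hS.smul_mk, hS.smul_mk, smul_assoc]; rfl

instance {S : AddSubgroup A} [IsHModuleAlgebra k H A] (hS : IsHIdeal H S) :
    IsHModuleAlgebra k H (A ⧸ hS.ideal) where
  smul_one h := by
    rw [← map_one (Ideal.Quotient.mk hS.ideal), hS.smul_mk,
      IsHModuleAlgebra.smul_one (k := k)]; rfl
  smul_mul h x y := by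
    obtain ⟨a, rfl⟩ := Ideal.Quotient.mk_surjective x
    obtain ⟨b, rfl⟩ := Ideal.Quotient.mk_surjective y
    rw [← map_mul, hS.smul_mk, IsHModuleAlgebra.smul_mul (k := k)]
    generalize (Coalgebra.comul h : H ⊗[k] H) = t
    induction t using TensorProduct.induction_on with
    | zero => simp
    | tmul p q => simp [hS.smul_mk]
    | add s t hs ht => simp only [map_add, hs, ht]

/-- The quotient module algebra by an `H`-stable ideal. -/
noncomputable def IsHIdeal.quotient (k : Type u) [CommRing k] [HopfAlgebra k H] [Algebra k A]
    [IsScalarTower k H A] [IsHModuleAlgebra k H A] {S : AddSubgroup A} (hS : IsHIdeal H S) :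
    HModAlg.{u, v, w} k H where
  carrier := A ⧸ hS.ideal

theorem IsHIdeal.isHPrime_quotient [IsHModuleAlgebra k H A] {S : AddSubgroup A}
    (hS : IsHIdeal H S) (h1 : ∃ x, x ∉ S)
    (hp : ∀ K L : AddSubgroup A, IsHIdeal H K → IsHIdeal H L → S ≤ K → S ≤ L →
      (∀ x ∈ K, ∀ y ∈ L, x * y ∈ S) → K ≤ S ∨ L ≤ S) :
    IsHPrime k H (A ⧸ hS.ideal) := by
  refine ⟨?_, fun K L hKL => ?_⟩
  · obtain ⟨x, hx⟩ := h1
    exact ⟨Ideal.Quotient.mk hS.ideal x, 0, fun h => hx (Ideal.Quotient.eq_zero_iff_mem.1 h)⟩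
  · have hle : ∀ K : HStableIdeal k H (A ⧸ hS.ideal), S ≤ (Submodule.toAddSubgroup
        (R := hMulAlgebra k H (A ⧸ hS.ideal)) (M := A ⧸ hS.ideal) K).comap
          (Ideal.Quotient.mk hS.ideal : A →+ A ⧸ hS.ideal) := by
      intro K x hx
      change Ideal.Quotient.mk hS.ideal x ∈ K
      rw [Ideal.Quotient.eq_zero_iff_mem.2 (hS.mem_ideal.2 hx)]
      exact K.zero_mem
    have hbot : ∀ K : HStableIdeal k H (A ⧸ hS.ideal), (Submodule.toAddSubgroup
        (R := hMulAlgebra k H (A ⧸ hS.ideal)) (M := A ⧸ hS.ideal) K).comap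
          (Ideal.Quotient.mk hS.ideal : A →+ A ⧸ hS.ideal) ≤ S → K = ⊥ := by
      intro K hK
      refine eq_bot_iff.2 fun x hx => ?_
      obtain ⟨a, rfl⟩ := Ideal.Quotient.mk_surjective x
      exact Ideal.Quotient.eq_zero_iff_mem.2 (hS.mem_ideal.2 (hK hx))
    refine (hp _ _ ((HStableIdeal.isHIdeal K).comap _ fun _ _ => rfl)
      ((HStableIdeal.isHIdeal L).comap _ fun _ _ => rfl) (hle K) (hle L) ?_).imp
      (hbot K) (hbot L)
    intro x hx y hy
    refine hS.mem_ideal.1 (Ideal.Quotient.eq_zero_iff_mem.1 ?_)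
    rw [map_mul]
    exact hKL _ hx _ hy

variable [IsHModuleAlgebra k H A]

/-- Otherwise the `H`-stable ideal generated by a would have square zero. This is the inductive step
for the sequences that detect prime ideals. -/
theorem IsHSemiprime.exists_mul_ne_zero (hA : IsHSemiprime k H A) {a : A} (ha : a ≠ 0) :
    ∃ b : A, b ≠ 0 ∧ ∃ u ∈ Submodule.span (EnvSmash k H A) {a},
      ∃ v ∈ Submodule.span (EnvSmash k H A) {a}, b = u * v := by
  by_contra! hc
  refine ha ((EnvSmash.isHIdeal (Submodule.span (EnvSmash k H A) {a})).eq_zero_of_sq hA ?_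
    (Submodule.mem_span_singleton_self a))
  intro x hx y hy
  by_contra hxy
  exact hc _ hxy x hx y hy rfl

/-- This is the m-sequence argument of noncommutative prime ideal theory. Starting from x, each term
is a nonzero product of two elements of the `H`-stable ideal generated by its predecessor; P is
maximal among the `H`-stable ideals containing no term. -/
theorem IsHSemiprime.exists_prime (hA : IsHSemiprime k H A) {x : A} (hx : x ≠ 0) :
    ∃ P : Submodule (EnvSmash k H A) A, x ∉ P ∧
      IsHPrime k H (A ⧸ (EnvSmash.isHIdeal P).ideal) := by
  choose f hf0 hf using fun a : {a : A // a ≠ 0} => hA.exists_mul_ne_zero a.2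
  obtain ⟨s, hs0, hs⟩ : ∃ s : ℕ → {a : A // a ≠ 0}, (s 0 : A) = x ∧
      ∀ n, ∃ u ∈ Submodule.span (EnvSmash k H A) {(s n : A)},
        ∃ v ∈ Submodule.span (EnvSmash k H A) {(s n : A)}, (s (n + 1) : A) = u * v :=
    ⟨fun n => Nat.rec ⟨x, hx⟩ (fun _ a => ⟨f a, hf0 a⟩) n, rfl, fun n => hf _⟩
  have hmono : ∀ (K : Submodule (EnvSmash k H A) A) (i j : ℕ), i ≤ j →
      (s i : A) ∈ K → (s j : A) ∈ K := by
    intro K i j hij hi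
    induction j, hij using Nat.le_induction with
    | base => exact hi
    | succ n _ ih =>
      obtain ⟨u, hu, v, hv, h⟩ := hs n
      rw [h]
      exact (EnvSmash.isHIdeal K).mul_left u
        ((Submodule.span_singleton_le_iff_mem _ _).2 ih hv)
  -- A term lying in the supremum of a chain already lies in a member of it; the zero ideal
  -- qualifies because all terms are nonzero.
  obtain ⟨P, -, hP⟩ := zorn_le_nonempty₀ {N : Submodule (EnvSmash k H A) A | ∀ n, (s n : A) ∉ N}
    (by
      intro c hc hchain y hy
      refine ⟨sSup c, fun n hn => ?_, fun z hz => le_sSup hz⟩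
      obtain ⟨N, hN, hn⟩ := (Submodule.mem_sSup_of_directed ⟨y, hy⟩ hchain.directedOn).1 hn
      exact hc hN n hn) ⊥ (fun n hn => (s n).2 hn)
  have hxP : x ∉ P := hs0 ▸ hP.prop 0
  refine ⟨P, hxP, IsHIdeal.isHPrime_quotient (EnvSmash.isHIdeal P) ⟨x, hxP⟩ ?_⟩
  intro K L hK hL hPK hPL hKL
  have key : ∀ K : AddSubgroup A, IsHIdeal H K → P.toAddSubgroup ≤ K → ¬ K ≤ P.toAddSubgroup →
      ∃ N : Submodule (EnvSmash k H A) A, (∀ x ∈ N, x ∈ K) ∧ ∃ n, (s n : A) ∈ N := by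
    intro K hK hPK hKP
    let N : Submodule (EnvSmash k H A) A := EnvSmash.mkSubmodule K fun a b h x hx => by
      rw [EnvSmash.tmul_smul]
      exact hK.mul_right b (hK.mul_left a (hK.smul h hx))
    refine ⟨N, fun x hx => hx, ?_⟩
    by_contra! hn
    exact hKP (hP.le_of_ge (y := N) hn hPK)
  by_contra! hcon
  obtain ⟨N, hN, i, hi⟩ := key K hK hPK hcon.1
  obtain ⟨N', hN', j, hj⟩ := key L hL hPL hcon.2
  -- From the larger index on, the terms lie in both ideals, so the next term uv lies in the product
  -- KL ⊆ P, which avoids the sequence.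
  obtain ⟨u, hu, v, hv, h⟩ := hs (max i j)
  refine hP.prop (max i j + 1) ?_
  rw [h]
  exact hKL u (hN _ ((Submodule.span_singleton_le_iff_mem _ _).2
      (hmono N i _ (le_max_left i j) hi) hu)) v
    (hN' _ ((Submodule.span_singleton_le_iff_mem _ _).2
      (hmono N' j _ (le_max_right i j) hj) hv))

theorem isSubdirectProductOfHPrimes (hA : IsHSemiprime k H A) :
    IsSubdirectProductOfHPrimes k H A := by
  choose P hxP hP using fun x : {a : A // a ≠ 0} => hA.exists_prime x.2
  refine ⟨{a : A // a ≠ 0}, fun x => (EnvSmash.isHIdeal (P x)).quotient k,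
    fun x => Ideal.Quotient.mkₐ k (EnvSmash.isHIdeal (P x)).ideal, hP,
    fun x => Ideal.Quotient.mkₐ_surjective k _, fun x h a => rfl, fun a b hab => ?_⟩
  by_contra hne
  have h1 := congrFun hab ⟨a - b, sub_ne_zero.2 hne⟩
  exact hxP ⟨a - b, sub_ne_zero.2 hne⟩ (Ideal.Quotient.eq.1 h1)

end Quotient

/-! ### Transport of a ring structure along an additive surjection -/

/-- The ring structure on an additive group `M` transported along a surjective additive map from
a ring whose kernel is a two-sided ideal. -/
noncomputable abbrev ringOfSurjective {B M : Type*} [Ring B] [AddCommGroup M] (φ : B →+ M)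
    (hφ : Function.Surjective φ) (hl : ∀ s t, φ s = 0 → φ (s * t) = 0)
    (hr : ∀ s t, φ t = 0 → φ (s * t) = 0) : Ring M :=
  -- The product does not depend on the chosen preimages; all ring axioms then descend from B.
  have hmul : ∀ s t, φ (Function.surjInv hφ (φ s) * Function.surjInv hφ (φ t)) = φ (s * t) := by
    intro s t
    have h1 := hl (Function.surjInv hφ (φ s) - s) (Function.surjInv hφ (φ t))
      (by rw [map_sub, Function.surjInv_eq hφ, sub_self])
    have h2 := hr s (Function.surjInv hφ (φ t) - t)
      (by rw [map_sub, Function.surjInv_eq hφ, sub_self])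
    rw [sub_mul, map_sub, sub_eq_zero] at h1
    rw [mul_sub, map_sub, sub_eq_zero] at h2
    exact h1.trans h2
  { (inferInstance : AddCommGroup M) with
    mul := fun x y => φ (Function.surjInv hφ x * Function.surjInv hφ y)
    one := φ 1
    left_distrib := by
      refine hφ.forall₃.2 fun x y z => ?_
      change φ (_ * Function.surjInv hφ (φ y + φ z)) = φ (_ * _) + φ (_ * _)
      rw [← map_add, hmul, hmul, hmul, mul_add, map_add]
    right_distrib := by
      refine hφ.forall₃.2 fun x y z => ?_
      change φ (Function.surjInv hφ (φ x + φ y) * _) = φ (_ * _) + φ (_ * _)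
      rw [← map_add, hmul, hmul, hmul, add_mul, map_add]
    zero_mul := by
      refine hφ.forall.2 fun x => ?_
      change φ (Function.surjInv hφ 0 * _) = 0
      rw [← map_zero φ, hmul, zero_mul]
    mul_zero := by
      refine hφ.forall.2 fun x => ?_
      change φ (_ * Function.surjInv hφ 0) = 0
      rw [← map_zero φ, hmul, mul_zero]
    mul_assoc := by
      refine hφ.forall₃.2 fun x y z => ?_
      change φ (Function.surjInv hφ (φ (_ * _)) * _) = φ (_ * Function.surjInv hφ (φ (_ * _)))
      rw [hmul x y, hmul y z, hmul, hmul, mul_assoc]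
    one_mul := by
      refine hφ.forall.2 fun x => ?_
      change φ (Function.surjInv hφ (φ 1) * _) = _
      rw [hmul, one_mul]
    mul_one := by
      refine hφ.forall.2 fun x => ?_
      change φ (_ * Function.surjInv hφ (φ 1)) = _
      rw [hmul, mul_one] }

theorem ringOfSurjective_map_mul {B M : Type*} [Ring B] [AddCommGroup M] (φ : B →+ M)
    (hφ : Function.Surjective φ) (hl : ∀ s t, φ s = 0 → φ (s * t) = 0)
    (hr : ∀ s t, φ t = 0 → φ (s * t) = 0) (s t : B) :
    letI := ringOfSurjective φ hφ hl hr
    φ s * φ t = φ (s * t) := by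
  change φ (Function.surjInv hφ (φ s) * Function.surjInv hφ (φ t)) = φ (s * t)
  have h1 := hl (Function.surjInv hφ (φ s) - s) (Function.surjInv hφ (φ t))
    (by rw [map_sub, Function.surjInv_eq hφ, sub_self])
  have h2 := hr s (Function.surjInv hφ (φ t) - t)
    (by rw [map_sub, Function.surjInv_eq hφ, sub_self])
  rw [sub_mul, map_sub, sub_eq_zero] at h1
  rw [mul_sub, map_sub, sub_eq_zero] at h2
  exact h1.trans h2

/-! ### The self-injective hull and its module algebra structure -/

section Hull

open EnvSmash

variable {k : Type u} {H : Type v} {A : Type w} [CommRing k] [Ring H] [HopfAlgebra k H]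
  [Ring A] [Algebra k A] [Module H A] [IsScalarTower k H A] [IsHModuleAlgebra k H A]
  {E : Type x} [AddCommGroup E] [Module (EnvSmash k H A) E]

variable (k H A E) in
/-- The self-injective hull of `A` as an `Aᵉ #_ν H`-module. -/
abbrev EnvHull : Type x := selfInjectiveHull (EnvSmash k H A) A E

variable (k H A E) in
/-- The endomorphism ring of the self-injective hull. -/
abbrev EnvHullEnd : Type x := Module.End (EnvSmash k H A) (EnvHull k H A E)

/-- Injectivity of E extends g to a map q : Â → E. Its values stay in Â, since q composed with a map
A → Â is again one of the maps A → E whose images span Â. -/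
theorem EnvHull.exists_extension {ι : A →ₗ[EnvSmash k H A] E} (hι : IsInjectiveHull ι)
    {X : Type*} [AddCommGroup X] [Module (EnvSmash k H A) X]
    (i : X →ₗ[EnvSmash k H A] EnvHull k H A E) (hi : Function.Injective i)
    (g : X →ₗ[EnvSmash k H A] EnvHull k H A E) : ∃ f : EnvHullEnd k H A E, ∀ x, f (i x) = g x := by
  obtain ⟨q, hq⟩ := hι.baer.extension_property i hi
    ((selfInjectiveHull (EnvSmash k H A) A E).subtype ∘ₗ g)
  have hmem : ∀ y, q y ∈ selfInjectiveHull (EnvSmash k H A) A E := by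
    rintro ⟨y, hy⟩
    refine Submodule.iSup_induction' _
      (motive := fun y hy => q ⟨y, hy⟩ ∈ selfInjectiveHull (EnvSmash k H A) A E) ?_ ?_ ?_ hy
    · rintro p _ ⟨a, rfl⟩
      exact le_iSup (fun f : A →ₗ[EnvSmash k H A] E => LinearMap.range f)
        (q ∘ₗ p.codRestrict _ fun m => le_iSup
          (fun f : A →ₗ[EnvSmash k H A] E => LinearMap.range f) p ⟨m, rfl⟩) ⟨a, rfl⟩
    · exact (congrArg (· ∈ _) (map_zero q)).mpr (Submodule.zero_mem _)
    · intro y z hy hz h1 h2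
      have := Submodule.add_mem _ h1 h2
      rwa [← map_add] at this
  refine ⟨q.codRestrict _ hmem, fun x => Subtype.ext ?_⟩
  exact LinearMap.congr_fun hq x

variable (ι : A →ₗ[EnvSmash k H A] E)

theorem toSelfInjectiveHull_mul_left (a b : A) : toSelfInjectiveHull ι (a * b) =
    (tmul a 1 1 : EnvSmash k H A) • toSelfInjectiveHull ι b := by
  rw [← map_smul, left_smul]

theorem toSelfInjectiveHull_mul_right (a b : A) : toSelfInjectiveHull ι (a * b) =
    (tmul 1 b 1 : EnvSmash k H A) • toSelfInjectiveHull ι a := by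
  rw [← map_smul, right_smul]

variable {ι}

theorem toSelfInjectiveHull_injective (hι : IsInjectiveHull ι) :
    Function.Injective (toSelfInjectiveHull ι) :=
  fun _ _ h => hι.injective (congrArg Subtype.val h)

/-- Each map A → Â extends along A ⊆ Â to an endomorphism, so Â is the sum of the images f(A). No
case for zero is required, since f = 0 is allowed. -/
theorem EnvHull.exists_end (hι : IsInjectiveHull ι) (y : EnvHull k H A E)
    {P : EnvHull k H A E → Prop}
    (h0 : ∀ (f : EnvHullEnd k H A E) (a : A), P (f (toSelfInjectiveHull ι a)))
    (hadd : ∀ y z, P y → P z → P (y + z)) : P y := by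
  obtain ⟨y, hy⟩ := y
  refine Submodule.iSup_induction' _ (motive := fun y hy => P ⟨y, hy⟩) ?_ ?_ ?_ hy
  · rintro p _ ⟨a, rfl⟩
    obtain ⟨f, hf⟩ := EnvHull.exists_extension hι (toSelfInjectiveHull ι)
      (toSelfInjectiveHull_injective hι) (p.codRestrict _ fun m => le_iSup
          (fun f : A →ₗ[EnvSmash k H A] E => LinearMap.range f) p ⟨m, rfl⟩)
    have := h0 f a
    rwa [hf] at this
  · have := h0 0 0
    rwa [map_zero, map_zero] at this
  · intro y z hy hz h1 h2
    exact hadd _ _ h1 h2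

theorem EnvHull.hom_eq_zero (hA : IsHSemiprime k H A) (hι : IsInjectiveHull ι)
    (f : A →ₗ[EnvSmash k H A] EnvHull k H A E) (hf : IsEssentialSubmodule (LinearMap.ker f)) :
    f = 0 := by
  have := eq_zero_of_essential_ker hA hι ((selfInjectiveHull (EnvSmash k H A) A E).subtype ∘ₗ f)
    (by rwa [LinearMap.ker_comp_of_ker_eq_bot _ (Submodule.ker_subtype _)])
  ext a
  exact LinearMap.congr_fun this a

theorem EnvHull.essential_range (hι : IsInjectiveHull ι) :
    IsEssentialSubmodule (LinearMap.range (toSelfInjectiveHull ι)) := by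
  have h := hι.essential.comap (selfInjectiveHull (EnvSmash k H A) A E).subtype
  intro L hL
  refine h L (eq_bot_iff.2 ?_)
  rintro y ⟨⟨a, ha⟩, hy⟩
  rw [← hL]
  exact ⟨⟨a, Subtype.ext ha⟩, hy⟩

/-- For every endomorphism p, the map a ↦ (f - g)(p(a)) vanishes where p(a) ∈ A. That set is
essential in A, so the map is zero, and the elements p(a) generate Â. -/
theorem EnvHull.end_ext (hA : IsHSemiprime k H A) (hι : IsInjectiveHull ι)
    {f g : EnvHullEnd k H A E}
    (h : ∀ a, f (toSelfInjectiveHull ι a) = g (toSelfInjectiveHull ι a)) : f = g := by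
  ext1 y
  refine EnvHull.exists_end hι y (P := fun y => f y = g y) (fun p a => ?_)
    fun y z hy hz => by rw [map_add, map_add, hy, hz]
  have := EnvHull.hom_eq_zero hA hι ((f - g) ∘ₗ p ∘ₗ toSelfInjectiveHull ι) (by
    have h1 := (EnvHull.essential_range hι).comap (p ∘ₗ toSelfInjectiveHull ι)
    intro L hL
    refine h1 L (eq_bot_iff.2 ?_)
    rintro b ⟨⟨c, hc⟩, hb⟩
    rw [← hL]
    refine ⟨?_, hb⟩
    rw [SetLike.mem_coe, LinearMap.mem_ker, LinearMap.comp_apply, ← hc, LinearMap.sub_apply, h,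
      sub_self])
  exact sub_eq_zero.1 (LinearMap.congr_fun this a)

/-- On a product xy with f(x) and g(y) in A, bimodule linearity gives fg(xy) = f(x)g(y) = gf(xy).
The x with both f(x) and g(x) in A form an essential ideal, so the kernel of fg - gf on A, which
contains its products, is essential too. -/
theorem EnvHull.end_comm (hA : IsHSemiprime k H A) (hι : IsInjectiveHull ι)
    (f g : EnvHullEnd k H A E) (y : EnvHull k H A E) : f (g y) = g (f y) := by
  suffices f * g = g * f from LinearMap.congr_fun this y
  refine EnvHull.end_ext hA hι fun a => ?_
  have := EnvHull.hom_eq_zero hA hι ((f * g - g * f) ∘ₗ toSelfInjectiveHull ι) (by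
    refine (((EnvHull.essential_range hι).comap (f ∘ₗ toSelfInjectiveHull ι)).inf
      ((EnvHull.essential_range hι).comap (g ∘ₗ toSelfInjectiveHull ι))).of_mul_mem hA ?_
    rintro x ⟨⟨x', hx⟩, -⟩ y ⟨-, ⟨y', hy⟩⟩
    rw [LinearMap.comp_apply] at hx hy
    rw [LinearMap.mem_ker, LinearMap.comp_apply, LinearMap.sub_apply, Module.End.mul_apply,
      Module.End.mul_apply, sub_eq_zero]
    trans toSelfInjectiveHull ι (x' * y')
    · rw [toSelfInjectiveHull_mul_left, map_smul, ← hy, ← toSelfInjectiveHull_mul_left,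
        toSelfInjectiveHull_mul_right, map_smul, ← hx, ← toSelfInjectiveHull_mul_right]
    · rw [toSelfInjectiveHull_mul_right ι x y, map_smul, ← hx, ← toSelfInjectiveHull_mul_right,
        toSelfInjectiveHull_mul_left ι x' y, map_smul, ← hy, ← toSelfInjectiveHull_mul_left])
  exact sub_eq_zero.1 (LinearMap.congr_fun this a)

variable (ι) in
/-- The map `f ⊗ a ↦ f(a)` from `End(Â) ⊗ A` to `Â`. -/
noncomputable def evalHull : EnvHullEnd k H A E ⊗[ℤ] A →+ EnvHull k H A E :=
  (TensorProduct.lift (LinearMap.mk₂ ℤ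
    (fun (f : EnvHullEnd k H A E) (a : A) => f (toSelfInjectiveHull ι a))
    (fun _ _ _ => rfl) (fun _ _ _ => rfl) (fun _ _ _ => by rw [map_add, map_add])
    (fun c f a => by rw [map_zsmul, map_zsmul]))).toAddMonoidHom

theorem evalHull_tmul (f : EnvHullEnd k H A E) (a : A) :
    evalHull ι (f ⊗ₜ a) = f (toSelfInjectiveHull ι a) := rfl

theorem evalHull_surjective (hι : IsInjectiveHull ι) : Function.Surjective (evalHull ι) := by
  intro y
  refine EnvHull.exists_end hι y (P := fun y => ∃ s, evalHull ι s = y)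
    (fun f a => ⟨f ⊗ₜ a, rfl⟩) ?_
  rintro _ _ ⟨s, rfl⟩ ⟨t, rfl⟩
  exact ⟨s + t, map_add _ _ _⟩

/-- The right side depends on `s` only through its value in Â, so the kernel of evaluation is a
right ideal. Commutativity of the endomorphism ring enters here; the mirror statement
`evalHull_tmul_mul` does without it. -/
theorem evalHull_mul_tmul (hA : IsHSemiprime k H A) (hι : IsInjectiveHull ι)
    (s : EnvHullEnd k H A E ⊗[ℤ] A) (g : EnvHullEnd k H A E) (b : A) :
    evalHull ι (s * (g ⊗ₜ b)) = g ((tmul 1 b 1 : EnvSmash k H A) • evalHull ι s) := by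
  induction s using TensorProduct.induction_on with
  | zero => simp
  | add s t hs ht => simp only [add_mul, map_add, smul_add, hs, ht]
  | tmul f a =>
    rw [Algebra.TensorProduct.tmul_mul_tmul, evalHull_tmul, evalHull_tmul, Module.End.mul_apply,
      EnvHull.end_comm hA hι, toSelfInjectiveHull_mul_right, map_smul]

theorem evalHull_tmul_mul (f : EnvHullEnd k H A E) (a : A) (t : EnvHullEnd k H A E ⊗[ℤ] A) :
    evalHull ι ((f ⊗ₜ a) * t) = f ((tmul a 1 1 : EnvSmash k H A) • evalHull ι t) := by
  induction t using TensorProduct.induction_on with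
  | zero => simp
  | add s t hs ht => simp only [mul_add, map_add, smul_add, hs, ht]
  | tmul g b =>
    rw [Algebra.TensorProduct.tmul_mul_tmul, evalHull_tmul, evalHull_tmul, Module.End.mul_apply,
      toSelfInjectiveHull_mul_left, map_smul]

/-- The ring structure on the self-injective hull with product `f(a) g(b) = (f ∘ g)(a b)`. -/
noncomputable abbrev EnvHull.ring (hA : IsHSemiprime k H A) (hι : IsInjectiveHull ι) :
    Ring (EnvHull k H A E) :=
  ringOfSurjective (B := EnvHullEnd k H A E ⊗[ℤ] A) (evalHull ι) (evalHull_surjective hι)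
    (fun s t hs => by
      induction t using TensorProduct.induction_on with
      | zero => simp
      | add t t' ht ht' => rw [mul_add, map_add, ht, ht', add_zero]
      | tmul g b => rw [evalHull_mul_tmul hA hι, hs, smul_zero, map_zero])
    (fun s t ht => by
      induction s using TensorProduct.induction_on with
      | zero => simp
      | add s s' hs hs' => rw [add_mul, map_add, hs, hs', add_zero]
      | tmul f a => rw [evalHull_tmul_mul, ht, smul_zero, map_zero])

section

variable (hA : IsHSemiprime k H A) (hι : IsInjectiveHull ι)

theorem EnvHull.mul_eq (s t : EnvHullEnd k H A E ⊗[ℤ] A) :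
    letI := EnvHull.ring hA hι
    evalHull ι s * evalHull ι t = evalHull ι (s * t) :=
  ringOfSurjective_map_mul (B := EnvHullEnd k H A E ⊗[ℤ] A) (evalHull ι) _ _ _ s t

theorem EnvHull.apply_mul_apply (f g : EnvHullEnd k H A E) (a b : A) :
    letI := EnvHull.ring hA hι
    f (toSelfInjectiveHull ι a) * g (toSelfInjectiveHull ι b) =
      f (g (toSelfInjectiveHull ι (a * b))) := by
  let := EnvHull.ring hA hι
  rw [← evalHull_tmul, ← evalHull_tmul, EnvHull.mul_eq,
    Algebra.TensorProduct.tmul_mul_tmul]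
  rfl

theorem EnvHull.coe_mul (a : A) (y : EnvHull k H A E) :
    letI := EnvHull.ring hA hι
    toSelfInjectiveHull ι a * y = (tmul a 1 1 : EnvSmash k H A) • y := by
  let := EnvHull.ring hA hι
  obtain ⟨t, rfl⟩ := evalHull_surjective hι y
  have := evalHull_tmul_mul (ι := ι) 1 a t
  rw [← EnvHull.mul_eq hA hι] at this
  exact this

theorem EnvHull.mul_coe (a : A) (y : EnvHull k H A E) :
    letI := EnvHull.ring hA hι
    y * toSelfInjectiveHull ι a = (tmul 1 a 1 : EnvSmash k H A) • y := by
  let := EnvHull.ring hA hι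
  obtain ⟨t, rfl⟩ := evalHull_surjective hι y
  have := evalHull_mul_tmul hA hι t 1 a
  rw [← EnvHull.mul_eq hA hι] at this
  exact this

/-- The inclusion of `A` into its self-injective hull as a ring homomorphism. -/
noncomputable abbrev EnvHull.ofRing :
    letI := EnvHull.ring hA hι
    A →+* EnvHull k H A E :=
  letI := EnvHull.ring hA hι
  { (toSelfInjectiveHull ι).toAddMonoidHom with
    map_one' := rfl
    map_mul' := fun a b => (EnvHull.apply_mul_apply hA hι 1 1 a b).symm }

/-- The `k`-algebra structure on the self-injective hull. -/
noncomputable abbrev EnvHull.algebra :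
    letI := EnvHull.ring hA hι
    Algebra k (EnvHull k H A E) :=
  letI := EnvHull.ring hA hι
  -- The image of `k` is central because c ⊗ 1 = 1 ⊗ c in Aᵉ.
  RingHom.toAlgebra' ((EnvHull.ofRing hA hι).comp (algebraMap k A)) (fun c y => by
    change toSelfInjectiveHull ι (algebraMap k A c) * y =
      y * toSelfInjectiveHull ι (algebraMap k A c)
    rw [EnvHull.coe_mul, EnvHull.mul_coe]
    congr 1
    simp only [tmul, Algebra.algebraMap_eq_smul_one, MulOpposite.op_smul,
      TensorProduct.smul_tmul]
    rfl)

end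

theorem exists_hModAlg_envHull (hA : IsHSemiprime k H A) (hι : IsInjectiveHull ι) :
    ∃ (D : HModAlg.{u, v, x} k H)
      (e : selfInjectiveHull (EnvSmash k H A) A E ≃+ D) (j : A →ₐ[k] D),
      (∀ a : A, j a = e (toSelfInjectiveHull ι a)) ∧
      Function.Injective j ∧
      (∀ (h : H) (a : A), j (h • a) = h • j a) ∧
      (∀ (a b : A) (h : H) (y : selfInjectiveHull (EnvSmash k H A) A E),
        e ((EnvSmash.tmul a b h : EnvSmash k H A) • y) = j a * (h • e y) * j b) ∧
      (∀ (f g : selfInjectiveHull (EnvSmash k H A) A E →ₗ[EnvSmash k H A]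
            selfInjectiveHull (EnvSmash k H A) A E) (a b : A),
        e (f (toSelfInjectiveHull ι a)) * e (g (toSelfInjectiveHull ι b)) =
          e (f (g (toSelfInjectiveHull ι (a * b))))) := by
  let := EnvHull.ring hA hι
  let := EnvHull.algebra hA hι
  let : Module H (EnvHull k H A E) := Module.compHom _ (ofHopf k H A)
  have hsmul : ∀ (h : H) (a : A), h • toSelfInjectiveHull ι a = toSelfInjectiveHull ι (h • a) := by
    intro h a
    rw [← ofHopf_smul (k := k) (A := A) h a, map_smul]; rfl
  have : IsScalarTower k H (EnvHull k H A E) := ⟨fun c h y => by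
    change (tmul 1 1 (c • h) : EnvSmash k H A) • y =
      toSelfInjectiveHull ι (algebraMap k A c) * ((tmul 1 1 h : EnvSmash k H A) • y)
    rw [EnvHull.coe_mul, tmul_smul_right, mul_smul]⟩
  have : IsHModuleAlgebra k H (EnvHull k H A E) :=
    { smul_one := fun h => by
        change h • toSelfInjectiveHull ι 1 = toSelfInjectiveHull ι (algebraMap k A _)
        rw [hsmul, IsHModuleAlgebra.smul_one (k := k)]
      smul_mul := fun h y z => by
        -- Both sides are additive in y and z, which reduces them to f(a) and g(b). Endomorphisms
        -- commute with `H`, so the axiom for A applies; what remains holds for any tensor `T` and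
        -- is checked on pure tensors.
        generalize hF : (Coalgebra.comul h : H ⊗[k] H) = T
        refine EnvHull.exists_end hι y (P := fun y => h • (y * z) = LinearMap.mul' k _
          (TensorProduct.map ((LinearMap.toSpanSingleton H _ y).restrictScalars k)
            ((LinearMap.toSpanSingleton H _ z).restrictScalars k) T)) (fun f a => ?_)
          fun y y' hy hy' => ?_
        · refine EnvHull.exists_end hι z (P := fun z => h • (f (toSelfInjectiveHull ι a) * z) =
            LinearMap.mul' k _ (TensorProduct.map
              ((LinearMap.toSpanSingleton H _ (f (toSelfInjectiveHull ι a))).restrictScalars k)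
              ((LinearMap.toSpanSingleton H _ z).restrictScalars k) T)) (fun g b => ?_)
            fun z z' hz hz' => ?_
          · rw [EnvHull.apply_mul_apply]
            have h1 : h • f (g (toSelfInjectiveHull ι (a * b))) =
                f (g (toSelfInjectiveHull ι (h • (a * b)))) := by
              rw [← hsmul]
              change ofHopf k H A h • _ = f (g (ofHopf k H A h • _))
              rw [map_smul, map_smul]
            rw [h1, IsHModuleAlgebra.smul_mul (k := k), hF]
            clear h1 hF
            induction T using TensorProduct.induction_on with
            | zero => simp
            | add s t hs ht => simp only [map_add, hs, ht]
            | tmul p q =>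
              have hc : ∀ (p : H) (f : EnvHullEnd k H A E) (a : A),
                  p • f (toSelfInjectiveHull ι a) = f (toSelfInjectiveHull ι (p • a)) := by
                intro p f a
                rw [← hsmul]
                exact (map_smul f (ofHopf k H A p) _).symm
              simp only [TensorProduct.map_tmul, LinearMap.mul'_apply, LinearMap.restrictScalars_apply,
                LinearMap.toSpanSingleton_apply, hc]
              exact (EnvHull.apply_mul_apply hA hι f g (p • a) (q • b)).symm
          · rw [mul_add, smul_add, hz, hz', ← map_add, ← LinearMap.add_apply,
              ← TensorProduct.map_add_right]
            congr 4
            ext r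
            simp
        · rw [add_mul, smul_add, hy, hy', ← map_add, ← LinearMap.add_apply,
            ← TensorProduct.map_add_left]
          congr 4
          ext r
          simp }
  refine ⟨{ carrier := EnvHull k H A E }, AddEquiv.refl _,
    { EnvHull.ofRing hA hι with commutes' := fun c => rfl }, fun a => rfl,
    toSelfInjectiveHull_injective hι, fun h a => (hsmul h a).symm, fun a b h y => ?_,
    fun f g a b => EnvHull.apply_mul_apply hA hι f g a b⟩
  change (tmul a b h : EnvSmash k H A) • y =
    toSelfInjectiveHull ι a * (ofHopf k H A h • y) * toSelfInjectiveHull ι b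
  rw [EnvHull.mul_coe, EnvHull.coe_mul, smul_smul, smul_smul, ofHopf_apply]
  congr 1
  simp only [tmul_one_mul, mulEnv_tmul, mul_one, one_mul]

end Hull

/-! ### Central invariants of a self-injective semiprime module algebra -/

section SelfInjective

open EnvSmash

variable {k : Type u} {H : Type v} {A : Type w} [CommRing k] [Ring H] [HopfAlgebra k H]
  [Ring A] [Algebra k A] [Module H A] [IsScalarTower k H A] [IsHModuleAlgebra k H A]

theorem mem_annihilator_iff {I : Set (centerInvariants k H A)} {x : A} :
    x ∈ (⨅ z ∈ I, (AddMonoidHom.mulLeft (z : A)).ker) ↔ ∀ z ∈ I, (z : A) * x = 0 := by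
  simp [AddSubgroup.mem_iInf, AddMonoidHom.mem_ker]

/-- Multiplication by a central invariant as an `Aᵉ #_ν H`-linear map. -/
def mulCenterInvariants (z : centerInvariants k H A) : A →ₗ[EnvSmash k H A] A :=
  mkLinearMap (AddMonoidHom.mulLeft (z : A)) fun a b h x => by
    simp only [tmul_smul, AddMonoidHom.coe_mulLeft, mul_centerInvariants_smul]
    simp only [← mul_assoc, centerInvariants_comm]

@[simp]
theorem mulCenterInvariants_apply (z : centerInvariants k H A) (x : A) :
    mulCenterInvariants z x = z * x := rfl

/-- The element is g(1): bimodule linearity makes it central, and `H`-linearity makes it invariant.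
-/
theorem exists_eq_mulCenterInvariants (g : A →ₗ[EnvSmash k H A] A) :
    ∃ z : centerInvariants k H A, ∀ x, g x = z * x := by
  have hl : ∀ a x, g (a * x) = a * g x := fun a x => by
    rw [← left_smul (k := k) (H := H), map_smul, left_smul]
  have hr : ∀ a x, g (x * a) = g x * a := fun a x => by
    rw [← right_smul (k := k) (H := H), map_smul, right_smul]
  refine ⟨⟨g 1, Subalgebra.mem_center_iff.2 fun a => ?_, fun h => ?_⟩, fun x => ?_⟩
  · rw [← hl, ← hr, mul_one, one_mul]
  · rw [← ofHopf_smul (k := k) h (g 1), ← map_smul, ofHopf_smul,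
      IsHModuleAlgebra.smul_one (k := k), Algebra.smul_def, ← hl, mul_one]
  · rw [← hr, one_mul]

/-- Over a self-injective module algebra, every functional relation compatible with the module
structure is contained in the graph of multiplication by a central invariant. -/
theorem exists_centerInvariants_of_graph (hi : IsSelfInjective (EnvSmash k H A) A)
    (G : AddSubgroup (A × A))
    (hl : ∀ (a : A) (p : A × A), p ∈ G → (a * p.1, a * p.2) ∈ G)
    (hr : ∀ (a : A) (p : A × A), p ∈ G → (p.1 * a, p.2 * a) ∈ G)
    (hs : ∀ (h : H) (p : A × A), p ∈ G → (h • p.1, h • p.2) ∈ G)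
    (hf : ∀ y, (0, y) ∈ G → y = 0) :
    ∃ z : centerInvariants k H A, ∀ p ∈ G, (z : A) * p.1 = p.2 := by
  let G' : Submodule (EnvSmash k H A) (A × A) := mkSubmodule G fun a b h p hp => by
    have : (tmul a b h : EnvSmash k H A) • p = (a * (h • p.1) * b, a * (h • p.2) * b) :=
      Prod.ext (tmul_smul a b h p.1) (tmul_smul a b h p.2)
    rw [this]
    exact hr b _ (hl a _ (hs h _ hp))
  have hG' : ∀ p ∈ G', p.1 = 0 → p.2 = 0 := by
    rintro ⟨x, y⟩ hp rfl
    exact hf y hp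
  -- The relation is the graph of a partial linear map, which self-injectivity extends to an
  -- endomorphism.
  obtain ⟨g, hg⟩ := hi _ G'.toLinearPMap.toFun
  obtain ⟨z, hz⟩ := exists_eq_mulCenterInvariants g
  refine ⟨z, fun p hp => ?_⟩
  have hp1 : p.1 ∈ G'.map (LinearMap.fst (EnvSmash k H A) A A) := ⟨p, hp, rfl⟩
  have h1 := Submodule.mem_graph_toLinearPMap hG' ⟨p.1, hp1⟩
  have h2 := hg ⟨p.1, hp1⟩
  rw [hz] at h2
  have h3 := hf (p.2 - G'.toLinearPMap ⟨p.1, hp1⟩) (by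
    have := G.sub_mem hp (show _ ∈ G from h1)
    rwa [Prod.mk_sub_mk, sub_self] at this)
  exact h2.trans (sub_eq_zero.1 h3).symm

/-- The relation z²x ↦ zx is functional: if z²x = 0, then zx lies in zA ∩ ann(z), which has square
zero. A central invariant w inducing it satisfies wz² = z. -/
theorem isVonNeumannRegular_centerInvariants (hA : IsHSemiprime k H A)
    (hi : IsSelfInjective (EnvSmash k H A) A) :
    IsVonNeumannRegular (centerInvariants k H A) := by
  intro z
  obtain ⟨w, hw⟩ := exists_centerInvariants_of_graph hi
    ((AddMonoidHom.mulLeft ((z * z : centerInvariants k H A) : A)).prod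
      (AddMonoidHom.mulLeft (z : A))).range
    (by
      rintro a _ ⟨x, rfl⟩
      refine ⟨a * x, ?_⟩
      simp only [AddMonoidHom.prod_apply, AddMonoidHom.coe_mulLeft, ← mul_assoc,
        centerInvariants_comm])
    (by
      rintro a _ ⟨x, rfl⟩
      exact ⟨x * a, by simp [mul_assoc]⟩)
    (by
      rintro h _ ⟨x, rfl⟩
      refine ⟨h • x, ?_⟩
      simp only [AddMonoidHom.prod_apply, AddMonoidHom.coe_mulLeft, mul_centerInvariants_smul])
    (by
      rintro _ ⟨x, hx⟩
      obtain ⟨h1, rfl⟩ := Prod.mk.inj hx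
      refine ((isHIdeal_map_mulLeft isHIdeal_top z).inf
        (isHIdeal_annihilator {z})).eq_zero_of_sq hA ?_ ⟨⟨x, trivial, rfl⟩, ?_⟩
      · rintro _ ⟨⟨a, -, rfl⟩, -⟩ y ⟨-, hy⟩
        have hy' := mem_annihilator_iff.1 hy z rfl
        rw [AddMonoidHom.coe_mulLeft, ← centerInvariants_comm, mul_assoc, hy', mul_zero]
      · refine mem_annihilator_iff.2 fun y hy => ?_
        rw [Set.mem_singleton_iff.1 hy]
        simpa [mul_assoc] using h1)
  refine ⟨w, ?_⟩
  have h1 := hw _ ⟨1, rfl⟩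
  have h2 : w * (z * z) = z := Subtype.ext (by simpa using h1)
  calc z * w * z = w * (z * z) := by ring
    _ = z := h2

/-- The map f is spread over A by x ↦ f(e)x whenever e ∈ N fixes x. Regularity provides such an e
for each x ∈ N. -/
theorem isSelfInjective_centerInvariants (hA : IsHSemiprime k H A)
    (hi : IsSelfInjective (EnvSmash k H A) A) :
    IsSelfInjective (centerInvariants k H A) (centerInvariants k H A) := by
  intro N f
  have hcomm : ∀ e e' : N, (e : centerInvariants k H A) * f e' = e' * f e := by
    intro e e'
    have : (e : centerInvariants k H A) • e' = (e' : centerInvariants k H A) • e :=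
      Subtype.ext (mul_comm _ _)
    rw [← smul_eq_mul, ← map_smul, this, map_smul, smul_eq_mul]
  -- The value is independent of the local unit: f(e)x = f(e)e'x = f(e')ex = f(e')x.
  have hind : ∀ (e e' : N) (x : A), (e : centerInvariants k H A) • x = x →
      (e' : centerInvariants k H A) • x = x → f e • x = f e' • x := by
    intro e e' x h h'
    conv_lhs => rw [← h', smul_smul, mul_comm, hcomm, mul_comm, mul_smul, h]
  let G : AddSubgroup (A × A) :=
    { carrier := {p | ∃ e : N, (e : centerInvariants k H A) • p.1 = p.1 ∧ p.2 = f e • p.1}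
      zero_mem' := ⟨0, by simp, by simp⟩
      neg_mem' := by
        rintro p ⟨e, h1, h2⟩
        exact ⟨e, by simp [h1], by simp [h2]⟩
      add_mem' := by
        rintro p q ⟨e, h1, h2⟩ ⟨e', h1', h2'⟩
        -- The element e + e' - ee' is a common local unit, since 1 - (e + e' - ee') = (1 - e)(1 -
        -- e').
        have h3 : ((e + e' - (e : centerInvariants k H A) • e' : N) :
            centerInvariants k H A) • p.1 = p.1 := by
          simp only [AddSubgroupClass.coe_sub, Submodule.coe_add, Submodule.coe_smul, smul_eq_mul,
            sub_smul, add_smul, mul_comm (e : centerInvariants k H A), mul_smul, h1]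
          abel
        have h4 : ((e + e' - (e : centerInvariants k H A) • e' : N) :
            centerInvariants k H A) • q.1 = q.1 := by
          simp only [AddSubgroupClass.coe_sub, Submodule.coe_add, Submodule.coe_smul, smul_eq_mul,
            sub_smul, add_smul, mul_smul, h1']
          abel
        refine ⟨_, by rw [Prod.fst_add, smul_add, h3, h4], ?_⟩
        rw [Prod.snd_add, Prod.fst_add, smul_add, h2, h2', hind _ _ _ h1 h3, hind _ _ _ h1' h4] }
  obtain ⟨z, hz⟩ := exists_centerInvariants_of_graph hi G
    (by
      rintro a p ⟨e, h1, h2⟩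
      refine ⟨e, ?_, ?_⟩
      · change ((e : centerInvariants k H A) : A) * (a * p.1) = a * p.1
        rw [← mul_assoc, ← centerInvariants_comm, mul_assoc]
        exact congrArg _ h1
      · change a * p.2 = (f e : A) * (a * p.1)
        rw [h2, ← mul_assoc, ← centerInvariants_comm, mul_assoc]; rfl)
    (by
      rintro a p ⟨e, h1, h2⟩
      refine ⟨e, ?_, ?_⟩
      · change ((e : centerInvariants k H A) : A) * (p.1 * a) = p.1 * a
        rw [← mul_assoc]
        exact congrArg (· * a) h1
      · change p.2 * a = (f e : A) * (p.1 * a)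
        rw [h2, ← mul_assoc]; rfl)
    (by
      rintro h p ⟨e, h1, h2⟩
      refine ⟨e, ?_, ?_⟩
      · change ((e : centerInvariants k H A) : A) * (h • p.1) = h • p.1
        rw [← mul_centerInvariants_smul]
        exact congrArg (h • ·) h1
      · change h • p.2 = (f e : A) * (h • p.1)
        rw [h2, ← mul_centerInvariants_smul]; rfl)
    (by
      rintro y ⟨e, h1, h2⟩
      simpa using h2)
  refine ⟨LinearMap.toSpanSingleton _ _ z, fun n => ?_⟩
  obtain ⟨b, hb⟩ := isVonNeumannRegular_centerInvariants hA hi n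
  have h1 := hz (n, f n) ⟨b • n, by
      change (((b * n) * n : centerInvariants k H A) : A) = n
      rw [mul_comm b, hb], by
      rw [map_smul]
      change (f n : A) = ((b * f n) * n : centerInvariants k H A)
      congr 1
      have hc : (n : centerInvariants k H A) * f (b • n) = (b • n : N) * f n := hcomm n (b • n)
      have hn : (b * n : centerInvariants k H A) • n = n := Subtype.ext (by
        rw [Submodule.coe_smul, smul_eq_mul, mul_comm b, hb])
      conv_lhs => rw [← hn, map_smul, smul_eq_mul]
      ring⟩
  rw [LinearMap.toSpanSingleton_apply, smul_eq_mul, mul_comm]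
  exact Subtype.ext h1

/-- Let I be the annihilator of m. Relate x to y when y is fixed by some e ∈ I and ix = iy for all i
∈ I. This is functional, since x = 0 gives y = ey = 0. It contains (m, 0) and each (i, i), so the
resulting w kills m and is the identity on I; essentiality of I then forces w = 1. -/
theorem isNonsingular_centerInvariants (hA : IsHSemiprime k H A)
    (hi : IsSelfInjective (EnvSmash k H A) A) :
    IsNonsingular (centerInvariants k H A) A := by
  intro m hm
  set I := LinearMap.ker (LinearMap.toSpanSingleton (centerInvariants k H A) A m) with hI
  have hIm : ∀ i ∈ I, i • m = 0 := fun i hi => hi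
  let G : AddSubgroup (A × A) :=
    { carrier := {p | (∃ e ∈ I, e • p.2 = p.2) ∧ ∀ i ∈ I, i • p.1 = i • p.2}
      zero_mem' := ⟨⟨0, I.zero_mem, by simp⟩, by simp⟩
      neg_mem' := by
        rintro p ⟨⟨e, he, h1⟩, h2⟩
        exact ⟨⟨e, he, by simp [h1]⟩, fun i hi => by simp [h2 i hi]⟩
      add_mem' := by
        rintro p q ⟨⟨e, he, h1⟩, h2⟩ ⟨⟨e', he', h1'⟩, h2'⟩
        refine ⟨⟨e + e' - e • e', I.sub_mem (I.add_mem he he') (I.smul_mem e he'), ?_⟩,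
          fun i hi => by simp [h2 i hi, h2' i hi]⟩
        rw [Prod.snd_add, smul_add]
        congr 1
        · rw [smul_eq_mul, mul_comm, sub_smul, add_smul, mul_smul, h1]
          abel
        · rw [smul_eq_mul, sub_smul, add_smul, mul_smul, h1']
          abel }
  have hl : ∀ (z : centerInvariants k H A) (a x : A), z • (a * x) = a * z • x := by
    intro z a x
    change (z : A) * (a * x) = a * (z * x)
    rw [← mul_assoc, ← centerInvariants_comm, mul_assoc]
  have hr : ∀ (z : centerInvariants k H A) (a x : A), z • (x * a) = z • x * a := by
    intro z a x
    exact (mul_assoc _ _ _).symm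
  have hs : ∀ (z : centerInvariants k H A) (h : H) (x : A), z • h • x = h • z • x :=
    fun z h x => (mul_centerInvariants_smul z h x).symm
  obtain ⟨w, hw⟩ := exists_centerInvariants_of_graph hi G
    (by
      rintro a p ⟨⟨e, he, h1⟩, h2⟩
      exact ⟨⟨e, he, by rw [hl, h1]⟩, fun i hi => by rw [hl, hl, h2 i hi]⟩)
    (by
      rintro a p ⟨⟨e, he, h1⟩, h2⟩
      exact ⟨⟨e, he, by rw [hr, h1]⟩, fun i hi => by rw [hr, hr, h2 i hi]⟩)
    (by
      rintro h p ⟨⟨e, he, h1⟩, h2⟩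
      exact ⟨⟨e, he, by rw [hs, h1]⟩, fun i hi => by rw [hs, hs, h2 i hi]⟩)
    (by
      rintro y ⟨⟨e, he, h1⟩, h2⟩
      have := h2 e he
      rw [smul_zero] at this
      exact h1.symm.trans this.symm)
  have hwm : (w : A) * m = 0 := hw (m, 0) ⟨⟨0, I.zero_mem, by simp⟩, fun i hi => by
    rw [smul_zero, hIm i hi]⟩
  have hwI : ∀ i ∈ I, w * i = i := fun i hi' => Subtype.ext (by
    obtain ⟨b, hb⟩ := isVonNeumannRegular_centerInvariants hA hi i
    refine hw (i, i) ⟨⟨b • i, I.smul_mem b hi', ?_⟩, fun _ _ => rfl⟩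
    change (((b * i) * i : centerInvariants k H A) : A) = i
    rw [mul_comm b, hb])
  -- An element t = c(1 - w) of I satisfies wt = t, hence t² = c(t - wt) = 0.
  have h1 : Submodule.span (centerInvariants k H A) {1 - w} = ⊥ := by
    refine hm _ (eq_bot_iff.2 ?_)
    rintro z ⟨hzI, hz⟩
    obtain ⟨c, rfl⟩ := Submodule.mem_span_singleton.1 hz
    have h2 := hwI _ hzI
    refine eq_zero_of_mul_self hA _ ?_
    have h3 : (c • (1 - w)) * (c • (1 - w)) = 0 := by
      have : (c • (1 - w)) * (c • (1 - w)) = c * (c • (1 - w) - w * c • (1 - w)) := by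
        simp only [smul_eq_mul]; ring
      rw [this, h2, sub_self, mul_zero]
    exact congrArg Subtype.val h3
  have h2 : 1 - w = 0 := by
    rwa [Submodule.span_singleton_eq_bot] at h1
  rw [sub_eq_zero] at h2
  rw [← h2] at hwm
  simpa using hwm

end SelfInjective

/-! ### Properties of the hull algebra -/

section HullAlgebra

open EnvSmash

variable {k : Type u} {H : Type v} {A : Type w} [CommRing k] [Ring H] [HopfAlgebra k H]
  [Ring A] [Algebra k A] [Module H A] [IsScalarTower k H A] [IsHModuleAlgebra k H A]
  {E : Type x} [AddCommGroup E] [Module (EnvSmash k H A) E]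

/-- `D` is a module algebra structure on the self-injective hull of `A`, extending the one
of `A`. -/
structure IsHullAlgebra (ι : A →ₗ[EnvSmash k H A] E) (D : HModAlg.{u, v, x} k H)
    (e : EnvHull k H A E ≃+ D) (j : A →ₐ[k] D) : Prop where
  apply_eq : ∀ a : A, j a = e (toSelfInjectiveHull ι a)
  injective : Function.Injective j
  map_smul : ∀ (h : H) (a : A), j (h • a) = h • j a
  tmul_smul : ∀ (a b : A) (h : H) (y : EnvHull k H A E),
    e ((EnvSmash.tmul a b h : EnvSmash k H A) • y) = j a * (h • e y) * j b
  mul : ∀ (f g : EnvHull k H A E →ₗ[EnvSmash k H A] EnvHull k H A E) (a b : A),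
    e (f (toSelfInjectiveHull ι a)) * e (g (toSelfInjectiveHull ι b)) =
      e (f (g (toSelfInjectiveHull ι (a * b))))

namespace IsHullAlgebra

variable {ι : A →ₗ[EnvSmash k H A] E} {D : HModAlg.{u, v, x} k H}
  {e : EnvHull k H A E ≃+ D} {j : A →ₐ[k] D}

/-- The element is f(1). The product formula gives f(1)g(b) = fg(b) and g(b)f(1) = gf(b), so
centrality is commutativity of the endomorphism ring. -/
theorem exists_eq_mul (hD : IsHullAlgebra ι D e j) (hA : IsHSemiprime k H A)
    (hι : IsInjectiveHull ι) (f : EnvHullEnd k H A E) :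
    ∃ z : centerInvariants k H D, ∀ y, e (f y) = z * e y := by
  have hl : ∀ y, e (f y) = e (f (toSelfInjectiveHull ι 1)) * e y := by
    intro y
    refine EnvHull.exists_end hι y
      (P := fun y => e (f y) = e (f (toSelfInjectiveHull ι 1)) * e y) (fun g b => ?_) ?_
    · rw [hD.mul, one_mul]
    · intro y z hy hz
      rw [map_add, map_add, map_add, hy, hz, mul_add]
  refine ⟨⟨e (f (toSelfInjectiveHull ι 1)), Subalgebra.mem_center_iff.2 fun d => ?_,
    fun h => ?_⟩, hl⟩
  · obtain ⟨y, rfl⟩ := e.surjective d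
    rw [← hl]
    refine EnvHull.exists_end hι y
      (P := fun y => e y * e (f (toSelfInjectiveHull ι 1)) = e (f y)) (fun g b => ?_) ?_
    · rw [hD.mul, mul_one, EnvHull.end_comm hA hι]
    · intro y z hy hz
      rw [map_add, map_add, map_add, add_mul, hy, hz]
  · have h1 := hD.tmul_smul 1 1 h (f (toSelfInjectiveHull ι 1))
    have h2 := hD.tmul_smul (algebraMap k A (Coalgebra.counit h)) 1 1
      (f (toSelfInjectiveHull ι 1))
    rw [map_one j, one_mul, mul_one] at h1
    rw [map_one j, mul_one, one_smul, AlgHom.commutes, ← Algebra.smul_def] at h2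
    rw [← h1, ← h2, ← f.map_smul, ← f.map_smul, ← _root_.map_smul, ← _root_.map_smul,
      EnvSmash.tmul_smul, EnvSmash.tmul_smul, IsHModuleAlgebra.smul_one (k := k)]
    simp

theorem exists_apply_eq (hD : IsHullAlgebra ι D e j) (z : centerInvariants k H D) :
    ∃ f : EnvHullEnd k H A E, ∀ y, e (f y) = z * e y := by
  refine ⟨mkLinearMap (e.symm.toAddMonoidHom.comp ((AddMonoidHom.mulLeft (z : D)).comp
    e.toAddMonoidHom)) fun a b h y => ?_, fun y => by simp⟩
  apply e.injective
  rw [hD.tmul_smul]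
  simp only [AddMonoidHom.comp_apply, AddEquiv.coe_toAddMonoidHom, AddMonoidHom.coe_mulLeft,
    AddEquiv.apply_symm_apply, hD.tmul_smul, mul_centerInvariants_smul]
  simp only [← mul_assoc, centerInvariants_comm]

theorem isHIdeal_comap (hD : IsHullAlgebra ι D e j) {S : AddSubgroup D} (hS : IsHIdeal H S) :
    IsHIdeal H (S.comap (j : A →+ D)) :=
  hS.comap (j : A →+* D) hD.map_smul

/-- An `H`-stable ideal of D is in particular an `Aᵉ #_ν H`-submodule of the hull, in which A is
essential. -/
theorem eq_zero_of_comap (hD : IsHullAlgebra ι D e j) (hι : IsInjectiveHull ι)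
    {S : AddSubgroup D} (hS : IsHIdeal H S) (h : ∀ a, j a ∈ S → a = 0) {y : D} (hy : y ∈ S) :
    y = 0 := by
  let L : Submodule (EnvSmash k H A) (EnvHull k H A E) :=
    mkSubmodule (S.comap e.toAddMonoidHom) fun a b h y hy => by
      change e _ ∈ S
      rw [hD.tmul_smul]
      exact hS.mul_right _ (hS.mul_left _ (hS.smul h hy))
  have hL : L = ⊥ := by
    refine EnvHull.essential_range hι L (eq_bot_iff.2 ?_)
    rintro _ ⟨⟨a, rfl⟩, ha⟩
    rw [h a (by rw [hD.apply_eq]; exact ha), map_zero]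
    exact Submodule.zero_mem _
  have : e.symm y ∈ L := by
    change e (e.symm y) ∈ S
    rwa [e.apply_symm_apply]
  rw [hL, Submodule.mem_bot] at this
  simpa using this

theorem isHSemiprime (hD : IsHullAlgebra ι D e j) (hA : IsHSemiprime k H A)
    (hι : IsInjectiveHull ι) : IsHSemiprime k H D := by
  intro K hK
  refine eq_bot_iff.2 fun y hy => hD.eq_zero_of_comap hι (HStableIdeal.isHIdeal K) ?_ hy
  intro a ha
  refine (hD.isHIdeal_comap (HStableIdeal.isHIdeal K)).eq_zero_of_sq hA ?_ ha
  intro x hx y hy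
  apply hD.injective
  rw [map_mul, map_zero]
  exact hK _ hx _ hy

/-- Restricted to the smash product over A, a partial map of D extends to an endomorphism of the
hull. That extension is multiplication by a central invariant of D, hence linear over the larger
smash product as well. -/
theorem isSelfInjective (hD : IsHullAlgebra ι D e j) (hA : IsHSemiprime k H A)
    (hι : IsInjectiveHull ι) : IsSelfInjective (EnvSmash k H D) D := by
  intro N f
  have hlin : ∀ (a b : A) (h : H) (y : EnvHull k H A E),
      e ((tmul a b h : EnvSmash k H A) • y) = (tmul (j a) (j b) h : EnvSmash k H D) • e y := by
    intro a b h y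
    rw [hD.tmul_smul, EnvSmash.tmul_smul]
  let N' : Submodule (EnvSmash k H A) (EnvHull k H A E) :=
    mkSubmodule (N.toAddSubgroup.comap e.toAddMonoidHom) fun a b h y hy => by
      change e _ ∈ N
      rw [hlin]
      exact N.smul_mem _ hy
  let f' : N' →ₗ[EnvSmash k H A] EnvHull k H A E := mkLinearMap
    { toFun := fun y => e.symm (f ⟨e y, y.2⟩)
      map_zero' := by
        rw [e.symm_apply_eq, map_zero, ← map_zero f]
        congr 1
        exact Subtype.ext (map_zero e)
      map_add' := fun y z => by
        rw [e.symm_apply_eq, map_add, e.apply_symm_apply, e.apply_symm_apply, ← map_add]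
        congr 1
        exact Subtype.ext (map_add e _ _) } fun a b h y => by
      change e.symm _ = (tmul a b h : EnvSmash k H A) • e.symm _
      rw [e.symm_apply_eq, hlin, e.apply_symm_apply, ← f.map_smul]
      congr 1
      exact Subtype.ext (hlin a b h y)
  obtain ⟨F, hF⟩ := EnvHull.exists_extension hι N'.subtype N'.injective_subtype f'
  obtain ⟨z, hz⟩ := hD.exists_eq_mul hA hι F
  refine ⟨mulCenterInvariants z, fun n => ?_⟩
  have hn : e.symm n ∈ N' := by
    change e (e.symm n) ∈ N
    rw [e.apply_symm_apply]; exact n.2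
  have h1 := hz (e.symm n)
  rw [e.apply_symm_apply] at h1
  rw [mulCenterInvariants_apply, ← h1]
  have h2 := hF ⟨e.symm n, hn⟩
  rw [Submodule.subtype_apply] at h2
  rw [h2]
  change e (e.symm (f _)) = _
  rw [e.apply_symm_apply]
  congr 1
  exact Subtype.ext (e.apply_symm_apply _)

/-- Multiplication by z on A extends to the hull, where it is multiplication by a central invariant
c; evaluation at 1 identifies c with the image of z. -/
theorem map_mem_centerInvariants (hD : IsHullAlgebra ι D e j) (hA : IsHSemiprime k H A)
    (hι : IsInjectiveHull ι) (z : centerInvariants k H A) :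
    j z ∈ centerInvariants k H D := by
  obtain ⟨f, hf⟩ := EnvHull.exists_extension hι (toSelfInjectiveHull ι)
    (toSelfInjectiveHull_injective hι) (toSelfInjectiveHull ι ∘ₗ mulCenterInvariants z)
  obtain ⟨c, hc⟩ := hD.exists_eq_mul hA hι f
  have h1 := hc (toSelfInjectiveHull ι 1)
  rw [← hD.apply_eq, map_one j, mul_one, hf] at h1
  have h2 : j z = c := by
    rw [← h1, hD.apply_eq]
    simp
  rw [h2]; exact c.2

/-- The inclusion `Z(A)^H ⊆ Z(Â)^H`. -/
def mapCenterInvariants (hD : IsHullAlgebra ι D e j) (hA : IsHSemiprime k H A)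
    (hι : IsInjectiveHull ι) : centerInvariants k H A →+* centerInvariants k H D where
  toFun z := ⟨j z, hD.map_mem_centerInvariants hA hι z⟩
  map_one' := Subtype.ext (map_one j)
  map_zero' := Subtype.ext (map_zero j)
  map_mul' _ _ := Subtype.ext (map_mul j _ _)
  map_add' _ _ := Subtype.ext (map_add j _ _)

theorem coe_mapCenterInvariants (hD : IsHullAlgebra ι D e j) (hA : IsHSemiprime k H A)
    (hι : IsInjectiveHull ι) (z : centerInvariants k H A) :
    (hD.mapCenterInvariants hA hι z : D) = j z := rfl

theorem mapCenterInvariants_injective (hD : IsHullAlgebra ι D e j) (hA : IsHSemiprime k H A)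
    (hι : IsInjectiveHull ι) : Function.Injective (hD.mapCenterInvariants hA hι) :=
  fun _ _ h => Subtype.ext (hD.injective (congrArg Subtype.val h))

theorem mem_centerInvariants_of_map (hD : IsHullAlgebra ι D e j) {a : A}
    (ha : j a ∈ centerInvariants k H D) : a ∈ centerInvariants k H A := by
  refine ⟨Subalgebra.mem_center_iff.2 fun b => hD.injective ?_, fun h => hD.injective ?_⟩
  · rw [map_mul, map_mul]
    exact Subalgebra.mem_center_iff.1 ha.1 (j b)
  · rw [hD.map_smul, ha.2 h, _root_.map_smul]

end IsHullAlgebra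

/-! ### Large central invariants and the maximal quotient ring -/

theorem CenterInvariantsLarge.exists_mem (hZ : CenterInvariantsLarge k H A) {S : AddSubgroup A}
    (hS : IsHIdeal H S) {x : A} (hx : x ∈ S) (hx0 : x ≠ 0) :
    ∃ z : centerInvariants k H A, (z : A) ∈ S ∧ z ≠ 0 := by
  obtain ⟨z, hz, hzS, hz0⟩ := hZ (hS.toHStableIdeal k) fun h => hx0 (by
    have : x ∈ hS.toHStableIdeal k := hx
    rwa [h] at this)
  exact ⟨⟨z, hz⟩, hzS, fun h => hz0 (congrArg Subtype.val h)⟩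

namespace IsHullAlgebra

variable {ι : A →ₗ[EnvSmash k H A] E} {D : HModAlg.{u, v, x} k H}
  {e : EnvHull k H A E ≃+ D} {j : A →ₐ[k] D}

/-- The annihilator of I in D is an `H`-stable ideal. Were its trace on A nonzero, largeness would
put a nonzero central invariant of A in it, contradicting density. -/
theorem eq_zero_of_isDenseIdeal (hD : IsHullAlgebra ι D e j) (hA : IsHSemiprime k H A)
    (hι : IsInjectiveHull ι) (hZ : CenterInvariantsLarge k H A)
    {I : Ideal (centerInvariants k H A)} (hI : IsDenseIdeal I) {y : D}
    (hy : ∀ d ∈ I, (hD.mapCenterInvariants hA hι d : D) * y = 0) : y = 0 := by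
  have hS := isHIdeal_annihilator (hD.mapCenterInvariants hA hι '' I)
  refine hD.eq_zero_of_comap hι hS (fun a ha => ?_) (mem_annihilator_iff.2 ?_)
  · by_contra ha0
    obtain ⟨z, hz, hz0⟩ := hZ.exists_mem (hD.isHIdeal_comap hS) ha ha0
    refine hz0 (hI z fun d hd => ?_)
    have h1 := mem_annihilator_iff.1 hz _ ⟨d, hd, rfl⟩
    refine Subtype.ext (hD.injective ?_)
    rw [mul_comm]
    exact (map_mul j _ _).trans (h1.trans (map_zero j).symm)
  · rintro _ ⟨d, hd, rfl⟩
    exact hy d hd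

/-- The ideal is {d : qd ∈ Z(A)^H}. Suppose r ≠ 0 annihilates it. The elements of A that q
multiplies into A form an essential ideal, which meets rA in a nonzero ideal and so, by largeness,
contains some nonzero central invariant z ∈ rA. -/
theorem exists_isDenseIdeal (hD : IsHullAlgebra ι D e j) (hA : IsHSemiprime k H A)
    (hι : IsInjectiveHull ι) (hZ : CenterInvariantsLarge k H A) (q : centerInvariants k H D) :
    ∃ I : Ideal (centerInvariants k H A), IsDenseIdeal I ∧
      ∀ d ∈ I, ∃ r, q * hD.mapCenterInvariants hA hι d = hD.mapCenterInvariants hA hι r := by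
  let I : Ideal (centerInvariants k H A) :=
    { carrier := {d | ∃ r, q * hD.mapCenterInvariants hA hι d = hD.mapCenterInvariants hA hι r}
      zero_mem' := ⟨0, by simp⟩
      add_mem' := by
        rintro a b ⟨r, hr⟩ ⟨s, hs⟩
        exact ⟨r + s, by rw [map_add, map_add, mul_add, hr, hs]⟩
      smul_mem' := by
        rintro c d ⟨r, hr⟩
        exact ⟨c * r, by rw [smul_eq_mul, map_mul, map_mul, ← hr, mul_left_comm]⟩ }
  refine ⟨I, fun r hr => ?_, fun d hd => hd⟩
  by_contra hr0
  obtain ⟨f, hf⟩ := hD.exists_apply_eq q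
  have hN := (EnvHull.essential_range hι).comap (f ∘ₗ toSelfInjectiveHull ι)
  have h1 : ((LinearMap.range (toSelfInjectiveHull ι)).comap (f ∘ₗ toSelfInjectiveHull ι)) ⊓
      LinearMap.range (mulCenterInvariants r) ≠ ⊥ := by
    intro h
    have h2 : (r : A) ∈ LinearMap.range (mulCenterInvariants r) := ⟨1, by simp⟩
    rw [hN _ h, Submodule.mem_bot] at h2
    exact hr0 (Subtype.ext h2)
  obtain ⟨x, hx, hx0⟩ := Submodule.exists_mem_ne_zero_of_ne_bot h1
  obtain ⟨z, ⟨⟨b, hb⟩, ⟨c, hc⟩⟩, hz0⟩ := hZ.exists_mem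
    (isHIdeal (((LinearMap.range (toSelfInjectiveHull ι)).comap (f ∘ₗ toSelfInjectiveHull ι)) ⊓
      LinearMap.range (mulCenterInvariants r))) hx hx0
  rw [mulCenterInvariants_apply] at hc
  have hqz : (q : D) * j z = j b := by
    rw [hD.apply_eq b, hb, LinearMap.comp_apply, hf, hD.apply_eq]
  have hbZ : b ∈ centerInvariants k H A := hD.mem_centerInvariants_of_map (by
    rw [← hqz]
    exact mul_mem q.2 (hD.map_mem_centerInvariants hA hι z))
  -- Since qz is a central invariant of A, z belongs to the ideal and rz = 0. With z = rc this gives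
  -- z² = 0.
  have hrz := hr z ⟨⟨b, hbZ⟩, Subtype.ext hqz⟩
  refine hz0 (eq_zero_of_mul_self hA z ?_)
  have h3 : (r : A) * z = 0 := congrArg Subtype.val hrz
  rw [← hc, mul_assoc, hc, centerInvariants_comm, ← mul_assoc, h3, zero_mul]

theorem isMaximalQuotientRing (hD : IsHullAlgebra ι D e j) (hA : IsHSemiprime k H A)
    (hι : IsInjectiveHull ι) (hZ : CenterInvariantsLarge k H A) :
    IsMaximalQuotientRing (hD.mapCenterInvariants hA hι) where
  injective := hD.mapCenterInvariants_injective hA hι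
  exists_dense := hD.exists_isDenseIdeal hA hι hZ
  eq_zero q I hI hq := Subtype.ext (hD.eq_zero_of_isDenseIdeal hA hι hZ hI fun d hd => by
    rw [← centerInvariants_comm]
    exact congrArg Subtype.val (hq d hd))
  exists_eq I f hI := by
    let i := hD.mapCenterInvariants hA hι
    -- The relation dy = f(d)x for all d ∈ I is functional because I is faithful on D, and it
    -- contains every pair (d, f(d)) since d'f(d) = f(d')d.
    let G : AddSubgroup (D × D) :=
      { carrier := {p | ∀ d : I, (i d : D) * p.2 = i (f d) * p.1}
        zero_mem' := fun d => by simp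
        neg_mem' := fun {p} hp d => by simp [hp d]
        add_mem' := fun {p q} hp hq d => by simp [mul_add, hp d, hq d] }
    obtain ⟨q, hq⟩ := exists_centerInvariants_of_graph (hD.isSelfInjective hA hι) G
      (fun a p hp d => by
        have := hp d
        simp only [← mul_assoc, ← centerInvariants_comm]
        simp only [mul_assoc, this])
      (fun a p hp d => by simp only [← mul_assoc, hp d])
      (fun h p hp d => by simp only [← mul_centerInvariants_smul, hp d])
      (fun y hy => hD.eq_zero_of_isDenseIdeal hA hι hZ hI fun d hd => by
        simpa using hy ⟨d, hd⟩)
    refine ⟨q, fun d => Subtype.ext (hq (i d, i (f d)) fun d' => ?_)⟩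
    have h1 : (d' : centerInvariants k H A) * f d = f d' * d := by
      have h2 : (d' : centerInvariants k H A) • d = (d : centerInvariants k H A) • d' :=
        Subtype.ext (mul_comm _ _)
      rw [← smul_eq_mul, ← f.map_smul, h2, f.map_smul, smul_eq_mul, mul_comm]
    have h2 := congrArg i h1
    rw [map_mul, map_mul] at h2
    exact congrArg Subtype.val h2

/-- An essential ideal of Z(A)^H is dense, because elements of square zero vanish there; and a dense
ideal annihilates no nonzero element of the hull. -/
theorem isNonsingular (hD : IsHullAlgebra ι D e j) (hA : IsHSemiprime k H A)
    (hι : IsInjectiveHull ι) (hZ : CenterInvariantsLarge k H A) :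
    IsNonsingular (centerInvariants k H A) A := by
  intro m hm
  let I : Ideal (centerInvariants k H A) :=
    LinearMap.ker (LinearMap.toSpanSingleton (centerInvariants k H A) A m)
  have hI : IsDenseIdeal I := by
    intro r hr
    have : Submodule.span (centerInvariants k H A) {r} = ⊥ := by
      refine hm _ (eq_bot_iff.2 ?_)
      rintro z ⟨hz, hzr⟩
      obtain ⟨c, rfl⟩ := Submodule.mem_span_singleton.1 hzr
      have h1 := hr _ hz
      refine eq_zero_of_mul_self hA _ ?_
      have h2 : (c • r) * (c • r) = 0 := by
        rw [smul_eq_mul] at h1 ⊢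
        rw [mul_assoc, h1, mul_zero]
      exact congrArg Subtype.val h2
    rwa [Submodule.span_singleton_eq_bot] at this
  refine hD.injective ?_
  rw [map_zero]
  refine hD.eq_zero_of_isDenseIdeal hA hι hZ hI fun d hd => ?_
  rw [hD.coe_mapCenterInvariants, ← map_mul]
  exact (congrArg j hd).trans (map_zero j)

end IsHullAlgebra

end HullAlgebra

theorem theorem5p3 {k : Type u} {H : Type v} {A : Type w} [CommRing k] [Ring H] [HopfAlgebra k H]
    [Ring A] [Algebra k A] [Module H A] [IsScalarTower k H A] [IsHModuleAlgebra k H A]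
    (hA : IsHSemiprime k H A)
    -- an injective hull `ι : A → E` of `A` as a module over `Aᵉ #_ν H`
    {E : Type x} [AddCommGroup E] [Module (EnvSmash k H A) E]
    (ι : A →ₗ[EnvSmash k H A] E) (hι : IsInjectiveHull ι) :
    -- properties of `A`
    (IsPolyform (EnvSmash k H A) A E ∧
      IsSubdirectProductOfHPrimes k H A ∧
      IsReduced (centerInvariants k H A)) ∧
    -- the self-injective hull of `A` carries the structure `D` of a left `H`-module algebra
    (∃ (D : HModAlg.{u, v, x} k H)
        (e : selfInjectiveHull (EnvSmash k H A) A E ≃+ D)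
        (j : A →ₐ[k] D),
      -- `A` is an `H`-module subalgebra, and the action of `Aᵉ #_ν H` is the given one
      (∀ a : A, j a = e (toSelfInjectiveHull ι a)) ∧
      Function.Injective j ∧
      (∀ (h : H) (a : A), j (h • a) = h • j a) ∧
      (∀ (a b : A) (h : H) (y : selfInjectiveHull (EnvSmash k H A) A E),
        e ((EnvSmash.tmul a b h : EnvSmash k H A) • y) = j a * (h • e y) * j b) ∧
      -- the product: `f(a) g(b) = (f ∘ g)(a b)` for endomorphisms `f`, `g` of the hull
      (∀ (f g : selfInjectiveHull (EnvSmash k H A) A E →ₗ[EnvSmash k H A]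
            selfInjectiveHull (EnvSmash k H A) A E) (a b : A),
        e (f (toSelfInjectiveHull ι a)) * e (g (toSelfInjectiveHull ι b)) =
          e (f (g (toSelfInjectiveHull ι (a * b))))) ∧
      -- properties of this algebra `D`
      IsHSemiprime k H D ∧
      IsSelfInjective (EnvSmash k H D) D ∧
      IsNonsingular (centerInvariants k H D) D ∧
      IsSelfInjective (centerInvariants k H D) (centerInvariants k H D) ∧
      IsVonNeumannRegular (centerInvariants k H D) ∧
      -- the case where `Z(A)^H` is large in `A`
      (CenterInvariantsLarge k H A →
        (∃ i : centerInvariants k H A →+* centerInvariants k H D,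
          (∀ z, (i z : D) = j (z : A)) ∧ IsMaximalQuotientRing i) ∧
        IsNonsingular (centerInvariants k H A) A)) := by
  refine ⟨⟨isPolyform_of_isHSemiprime hA hι, isSubdirectProductOfHPrimes hA,
    isReduced_centerInvariants hA⟩, ?_⟩
  obtain ⟨D, e, j, h1, h2, h3, h4, h5⟩ := exists_hModAlg_envHull hA hι
  have hD : IsHullAlgebra ι D e j := ⟨h1, h2, h3, h4, h5⟩
  have hs := hD.isHSemiprime hA hι
  have hi := hD.isSelfInjective hA hι
  exact ⟨D, e, j, h1, h2, h3, h4, h5, hs, hi, isNonsingular_centerInvariants hs hi,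
    isSelfInjective_centerInvariants hs hi, isVonNeumannRegular_centerInvariants hs hi,
    fun hZ => ⟨⟨hD.mapCenterInvariants hA hι, fun _ => rfl, hD.isMaximalQuotientRing hA hι hZ⟩,
      hD.isNonsingular hA hι hZ⟩⟩
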